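/- All graphs are finite and simple. Let $G$ be a planar graph with $|V(G)|\ge 4$, drawn in the plane: vertices are distinct points, edges are polygonal arcs (simple arcs made of finitely many straight segments) joining their ends and passing through no other vertices, and any two edges meet only in common ends. Let $F(G)$ be the set of faces of the drawing, i.e. the connected components of the complement of the drawing in the plane, including the unbounded one. An $i$-cycle is a cycle subgraph with $i$ vertices. Call two cycles $C$ and $C'$ of $G$ *dependent* if there is a sequence $C=C_1,C_2,\dots,C_t=C'$ of cycles of $G$ such that $C_\ell$ and $C_{\ell+1}$ have a common edge for $1\le \ell\le t-1$, and $|V(C_s)|=4$ for $2\le s\le t-1$. Suppose that for every $i$ with $3\le i\le 5$, every $i$-cycle $C$ of $G$ is dependent with at most $i-3$ 3-cycles other than $C$, and that for every $i\ge 6$, every $i$-cycle of $G$ is dependent with at most $i-2$ 3-cycles. Then $F(G)$ is finite and $|V(G)|\ge |F(G)|+2$. -/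

import Mathlib

/-- `IsPolygonalArc p q A`: the set `A` is a polygonal arc (a simple broken line, that is, a union of
finitely many straight segments that is homeomorphic to `[0, 1]`) in the plane with ends `p` and `q`.
It is traced from `p` to `q`: either it is a single nondegenerate segment, or a nondegenerate first
segment that meets the remaining polygonal arc only in the starting point of the latter.
The plane `ℝ²` is written as `ℂ`. -/
inductive IsPolygonalArc : ℂ → ℂ → Set ℂ → Prop
  | single (p q : ℂ) (hpq : p ≠ q) : IsPolygonalArc p q (segment ℝ p q)
  | cons (p q r : ℂ) (A : Set ℂ) (hpq : p ≠ q) (hA : IsPolygonalArc q r A)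
      (hmeet : segment ℝ p q ∩ A = {q}) : IsPolygonalArc p r (segment ℝ p q ∪ A)

/-- A drawing of the graph `G` in the plane without crossings: the vertices are distinct points, every
edge is a polygonal arc joining its two ends and passing through no other vertex, and two different
edges meet at most in common ends. (The value of `arc` at a pair that is not an edge plays no role.)
A graph is planar if it has such a drawing. -/
structure PlaneDrawing {V : Type*} (G : SimpleGraph V) where
  /-- the point that represents a vertex -/
  pos : V → ℂ
  /-- the arc that represents an edge -/
  arc : Sym2 V → Set ℂ
  pos_injective : Function.Injective pos
  isPolygonalArc : ∀ u v : V, G.Adj u v → IsPolygonalArc (pos u) (pos v) (arc s(u, v))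
  mem_of_pos_mem_arc : ∀ e ∈ G.edgeSet, ∀ v : V, pos v ∈ arc e → v ∈ e
  arc_inter_arc : ∀ e ∈ G.edgeSet, ∀ e' ∈ G.edgeSet, e ≠ e' →
    arc e ∩ arc e' ⊆ pos '' {v | v ∈ e ∧ v ∈ e'}

namespace PlaneDrawing

variable {V : Type*} {G : SimpleGraph V}

/-- The set of all points of the plane that are covered by the drawing. -/
def carrier (D : PlaneDrawing G) : Set ℂ :=
  Set.range D.pos ∪ ⋃ e ∈ G.edgeSet, D.arc e

/-- The faces of the drawing (the outer one included): the connected components of the complement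
of the drawing in the plane. -/
def faces (D : PlaneDrawing G) : Set (Set ℂ) :=
  (fun x : ℂ => connectedComponentIn D.carrierᶜ x) '' D.carrierᶜ

end PlaneDrawing

namespace SimpleGraph

variable {V : Type*} {G : SimpleGraph V}

/-- The subgraph `C` of `G` is a cycle with `i` vertices (equivalently, with `i` edges). -/
def IsCycleSubgraph (C : G.Subgraph) (i : ℕ) : Prop :=
  ∃ (u : V) (w : G.Walk u u), w.IsCycle ∧ w.length = i ∧ w.toSubgraph = C

/-- Two subgraphs of `G` have a common edge. -/
def HaveCommonEdge (C C' : G.Subgraph) : Prop :=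
  (C.edgeSet ∩ C'.edgeSet).Nonempty

/-- Two cycles `C`, `C'` of `G` are dependent: there is a sequence `S 0 = C, S 1, …, S t = C'` of cycles
of `G` in which consecutive members have a common edge and all members other than the first and the
last one are 4-cycles. -/
def DependentCycles (C C' : G.Subgraph) : Prop :=
  (∃ i, IsCycleSubgraph C i) ∧ (∃ i, IsCycleSubgraph C' i) ∧
    ∃ (t : ℕ) (S : ℕ → G.Subgraph), S 0 = C ∧ S t = C' ∧
      (∀ l < t, HaveCommonEdge (S l) (S (l + 1))) ∧
      ∀ s, 0 < s → s < t → IsCycleSubgraph (S s) 4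

/-- The set of the 3-cycles of `G`, other than `C` itself, with which the cycle `C` is dependent. -/
def dependentTriangles (C : G.Subgraph) : Set G.Subgraph :=
  {T | IsCycleSubgraph T 3 ∧ T ≠ C ∧ DependentCycles C T}

end SimpleGraph

/-! The proof is a discharging argument over faces. For a face `f`, `bd f` consists of the edges
that have `f` on exactly one side. This set is even at every vertex, hence an edge-disjoint union of
cycles, so neither facial walks nor connectivity of `G` are needed. Let m be the number of edges
that separate two faces. Each lies in two sets `bd f`, and m + 2 ≤ |V| + |F|
(`nontrivial_edgeSides_ncard_le`). If |bd f| is at least 4 on average (`four_mul_card_le_sum`), then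
2|F| ≤ m and the claim follows; with at most two faces it follows from |V| ≥ 4.

For the average, only triangular faces are in deficit. Starting from a triangle T, cross edges into
faces with four edges as long as possible; this is the cluster of T. A cycle that shares an edge
with a face of the cluster is dependent with T. By the hypothesis for i = 3, 4, clusters of
different triangles are disjoint, and all faces across the border of a cluster are big, that is,
have at least five edges. For a big face g let t(g) count the triangles whose cluster has an edge in
`bd g`, and c(g) those among them (`captive`) that have no other big neighbour. Every triangle is
counted at least twice in the sum of t + c (`two_mul_card_le_sum`), so it suffices that t(g) + c(g)
+ 8 ≤ 2|bd g| (`card_triangles_add_card_captive`). The hypotheses give t(B) + 5 ≤ 2|B| for every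
nonempty even edge set B, with 8 in place of 5 if |B| ≥ 5 (`card_triangles_even`). The borders of
captive clusters are disjoint nonempty even subsets of `bd g`; splitting `bd g` into them and a
remainder gains a slack of 5 for each piece.

The topology avoids the Jordan curve theorem. In polar coordinates the drawing near a point is a
bundle of rays, and its complement a cycle of sectors. This yields the sides of an edge, the
connectedness of the dual graph, and the evenness of `bd f` (a face indicator changes an even number
of times around a vertex). Euler's inequality is a rank bound: combinations of the angles under
which edges are seen, with zero net flow at the vertices, are locally constant off the drawing but
jump across each edge used. -/

namespace SimpleGraph

/-! ### Even edge sets and their cycles. -/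

variable {V : Type*}

/-- A set of edges in which every vertex has even degree. -/
def EvenEdges (B : Finset (Sym2 V)) : Prop :=
  open Classical in ∀ v : V, Even (B.filter (fun e => v ∈ e)).card

open Classical in
theorem EvenEdges.sdiff {A B : Finset (Sym2 V)} (hA : EvenEdges A) (hB : EvenEdges B)
    (h : A ⊆ B) : EvenEdges (B \ A) := by
  intro v
  have h1 : (B \ A).filter (fun e => v ∈ e) = B.filter (fun e => v ∈ e) \
      A.filter (fun e => v ∈ e) := by
    ext e; simp only [Finset.mem_filter, Finset.mem_sdiff]; tauto
  have h2 := Finset.card_sdiff_add_card_eq_card (Finset.filter_subset_filter (fun e => v ∈ e) h)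
  rw [h1]
  have := hA v
  have := hB v
  grind

open Classical in
theorem EvenEdges.biUnion {ι : Type*} (s : Finset ι) (f : ι → Finset (Sym2 V))
    (hf : ∀ i ∈ s, EvenEdges (f i)) (hd : (s : Set ι).PairwiseDisjoint f) :
    EvenEdges (s.biUnion f) := by
  intro v
  rw [Finset.filter_biUnion, Finset.card_biUnion]
  · exact Finset.even_sum _ fun i hi => hf i hi v
  · intro i hi j hj hij
    exact Finset.disjoint_filter_filter (hd hi hj hij)

/-- The first vertex of a longest path works: a second neighbour would prolong the path or close a
cycle. -/
theorem isAcyclic_exists_unique_adj [Finite V] {H : SimpleGraph V} (h : H.IsAcyclic) {a b : V}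
    (hab : H.Adj a b) : ∃ u, ∃! w, H.Adj u w := by
  have : Nonempty V := ⟨a⟩
  have ⟨u, v, p, hp, hmax⟩ := Walk.exists_isPath_forall_isPath_length_le_length H
  have hnil : ¬p.Nil := by
    intro hn
    have h1 := hmax a b (Walk.cons hab Walk.nil) (by simp [hab.ne])
    rw [Walk.length_eq_zero_iff.mpr hn] at h1
    simp at h1
  refine ⟨u, _, p.adj_snd hnil, fun w hadj ↦ ?_⟩
  apply h.eq_snd_of_adj_start hp hadj
  have : ¬(p.cons hadj.symm).IsPath := by grind [Walk.length_cons]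
  grind [hp.cons]

open Classical in
theorem even_of_isCycleSubgraph {G : SimpleGraph V} {C : G.Subgraph} {i : ℕ}
    {A : Finset (Sym2 V)} (hC : IsCycleSubgraph C i) (hA : C.edgeSet = A) :
    EvenEdges A ∧ A.card = i ∧ 3 ≤ i := by
  obtain ⟨u, w, hw, rfl, rfl⟩ := hC
  have h1 : A = w.edges.toFinset := by
    ext e
    rw [← Finset.mem_coe, ← hA]
    simp [Walk.edgeSet_toSubgraph]
  subst h1
  refine ⟨?_, ?_, hw.three_le_length⟩
  · intro v
    have := (hw.isTrail.even_countP_edges_iff v).2 (fun h => absurd rfl h)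
    rw [List.countP_eq_length_filter] at this
    have h1 : w.edges.toFinset.filter (fun e => v ∈ e)
        = (w.edges.filter (fun e => decide (v ∈ e))).toFinset := by
      ext e; simp
    rwa [h1, List.toFinset_card_of_nodup (hw.isTrail.edges_nodup.filter _)]
  · rw [List.toFinset_card_of_nodup hw.isTrail.edges_nodup, Walk.length_edges]

open Classical in
-- Without a cycle the edge set would be a nonempty forest, and a leaf has odd degree.
theorem EvenEdges.exists_cycle [Finite V] {G : SimpleGraph V} {B : Finset (Sym2 V)}
    (hB : EvenEdges B) (hG : (B : Set (Sym2 V)) ⊆ G.edgeSet) (hne : B.Nonempty) :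
    ∃ (C : G.Subgraph) (A : Finset (Sym2 V)), A ⊆ B ∧ IsCycleSubgraph C A.card ∧
      C.edgeSet = A := by
  set H := fromEdgeSet (B : Set (Sym2 V)) with hH
  have hdiag : ∀ e ∈ B, ¬ e.IsDiag := fun e he => G.not_isDiag_of_mem_edgeSet (hG he)
  have hHG : H ≤ G := by
    intro a b hab
    rw [hH, fromEdgeSet_adj] at hab
    exact hG hab.1
  have hHB : ∀ e, e ∈ H.edgeSet → e ∈ B := by
    intro e he
    rw [hH, edgeSet_fromEdgeSet] at he
    exact he.1
  have hcyc : ¬ H.IsAcyclic := by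
    intro hac
    obtain ⟨e, he⟩ := hne
    induction e with | _ a b =>
    have hab : H.Adj a b := by
      rw [hH, fromEdgeSet_adj]
      exact ⟨he, fun h => hdiag _ he (by simpa using h)⟩
    obtain ⟨u, w, huw, huniq⟩ := isAcyclic_exists_unique_adj hac hab
    have h1 : B.filter (fun e => u ∈ e) = {s(u, w)} := by
      ext e
      simp only [Finset.mem_filter, Finset.mem_singleton]
      constructor
      · rintro ⟨h1, h2⟩
        obtain ⟨x, rfl⟩ := h2
        have : x = w := huniq x (by
          rw [hH]
          simp only [fromEdgeSet_adj]
          exact ⟨h1, fun h => hdiag _ h1 (by simpa using h)⟩)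
        rw [this]
      · rintro rfl
        exact ⟨hHB _ huw, by simp⟩
    have := hB u
    rw [h1] at this
    simp at this
  rw [IsAcyclic] at hcyc
  push Not at hcyc
  obtain ⟨u, w, hw⟩ := hcyc
  have hw' : (w.mapLe hHG).IsCycle := hw.mapLe hHG
  refine ⟨(w.mapLe hHG).toSubgraph, w.edges.toFinset, ?_, ⟨u, w.mapLe hHG, hw', ?_, rfl⟩, ?_⟩
  · intro e he
    exact hHB e (w.edges_subset_edgeSet (List.mem_toFinset.1 he))
  · rw [List.toFinset_card_of_nodup hw.isTrail.edges_nodup, Walk.length_edges]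
    simp
  · ext e
    rw [Walk.edgeSet_toSubgraph]
    simp

theorem EvenEdges.three_le_card [Finite V] {G : SimpleGraph V} {B : Finset (Sym2 V)}
    (hB : EvenEdges B) (hG : (B : Set (Sym2 V)) ⊆ G.edgeSet) (hne : B.Nonempty) :
    3 ≤ B.card := by
  obtain ⟨C, A, hAB, hC, hA⟩ := hB.exists_cycle hG hne
  have := (even_of_isCycleSubgraph hC hA).2.2
  exact this.trans (Finset.card_le_card hAB)

open Classical in
-- After removal of a cycle the rest is even, so it is empty or has at least three edges; the latter
-- needs six edges in all.
theorem EvenEdges.exists_cycle_of_card_le [Finite V] {G : SimpleGraph V} {B : Finset (Sym2 V)}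
    (hB : EvenEdges B) (hG : (B : Set (Sym2 V)) ⊆ G.edgeSet) (hne : B.Nonempty)
    (h5 : B.card ≤ 5) :
    ∃ C : G.Subgraph, IsCycleSubgraph C B.card ∧ C.edgeSet = B := by
  obtain ⟨C, A, hAB, hC, hA⟩ := hB.exists_cycle hG hne
  have h3 := even_of_isCycleSubgraph hC hA
  by_cases hBA : B \ A = ∅
  · have : A = B := hAB.antisymm (Finset.sdiff_eq_empty_iff_subset.1 hBA)
    subst this
    exact ⟨C, hC, hA⟩
  · have h4 := (h3.1.sdiff hB hAB).three_le_card (G := G)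
      ((Finset.coe_subset.2 Finset.sdiff_subset).trans hG) (Finset.nonempty_iff_ne_empty.2 hBA)
    have := Finset.card_sdiff_add_card_eq_card hAB
    omega

end SimpleGraph

/-! ### Abstract face systems, and faces as cycles. -/

open Classical in
/-- The combinatorial data of the faces of a plane graph: to every face belongs the set of the edges
that have it on exactly one side. -/
structure FaceSystem {V : Type*} [Fintype V] (G : SimpleGraph V) (Φ : Type*) where
  /-- the edges that separate the face from another one -/
  bd : Φ → Finset (Sym2 V)
  bd_subset : ∀ f, (bd f : Set (Sym2 V)) ⊆ G.edgeSet
  exists_other : ∀ f, ∀ e ∈ bd f, ∃ g, g ≠ f ∧ ∀ h, e ∈ bd h ↔ h = f ∨ h = g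
  even_bd : ∀ f, SimpleGraph.EvenEdges (bd f)
  connected : ∀ S : Set Φ, (∀ e f g, e ∈ bd f → e ∈ bd g → f ∈ S → g ∈ S) → S = ∅ ∨ S = Set.univ
  ncard_le : {e | ∃ f, e ∈ bd f}.ncard + 2 ≤ Fintype.card V + Nat.card Φ

namespace FaceSystem

open SimpleGraph Finset Classical

variable {V : Type*} [Fintype V] {G : SimpleGraph V} {Φ : Type*} (F : FaceSystem G Φ)

/-- `F.Reach T f`: there is a sequence of faces from `T` to `f` in which consecutive faces share an
edge and all faces after the first one have four edges. -/
def Reach (T f : Φ) : Prop :=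
  Relation.ReflTransGen (fun a b => (F.bd b).card = 4 ∧ ∃ e, e ∈ F.bd a ∧ e ∈ F.bd b) T f

theorem Reach.quad {T f : Φ} (h : F.Reach T f) : f = T ∨ (F.bd f).card = 4 := by
  rcases Relation.ReflTransGen.cases_tail h with h | ⟨c, -, h, -⟩
  · exact Or.inl h
  · exact Or.inr h

/-- A cycle with the edge set `F.bd f`, if there is one. -/
noncomputable def cyc (f : Φ) : G.Subgraph :=
  if h : ∃ C : G.Subgraph, IsCycleSubgraph C (F.bd f).card ∧ C.edgeSet = F.bd f
  then h.choose else ⊥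

theorem two_faces {e : Sym2 V} {f g h : Φ} (hf : e ∈ F.bd f) (hg : e ∈ F.bd g) (hfg : f ≠ g)
    (hh : e ∈ F.bd h) : h = f ∨ h = g := by
  obtain ⟨k, hk, hk'⟩ := F.exists_other f e hf
  have h1 := (hk' g).1 hg
  have h2 := (hk' h).1 hh
  grind

section Finite

variable [Fintype Φ]

/-- The faces with three edges whose cluster of faces with four edges has an edge in `B`. -/
noncomputable def triangles (B : Finset (Sym2 V)) : Finset Φ :=
  univ.filter fun T => (F.bd T).card = 3 ∧ ∃ f, F.Reach T f ∧ ∃ e ∈ B, e ∈ F.bd f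

theorem mem_triangles {B : Finset (Sym2 V)} {T : Φ} :
    T ∈ F.triangles B ↔ (F.bd T).card = 3 ∧ ∃ f, F.Reach T f ∧ ∃ e ∈ B, e ∈ F.bd f := by
  simp [triangles]

theorem triangles_union (B B' : Finset (Sym2 V)) :
    F.triangles (B ∪ B') = F.triangles B ∪ F.triangles B' := by
  ext T
  simp only [mem_union, mem_triangles]
  grind

theorem triangles_biUnion (s : Finset Φ) (B : Φ → Finset (Sym2 V)) :
    F.triangles (s.biUnion B) = s.biUnion fun T => F.triangles (B T) := by
  ext T
  simp only [mem_biUnion, mem_triangles]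
  grind

/-- A face without separating edges forms a closed class by itself, hence would be the only face. -/
theorem bd_nonempty (h3 : 3 ≤ Fintype.card Φ) (f : Φ) : (F.bd f).Nonempty := by
  by_contra hf
  rw [not_nonempty_iff_eq_empty] at hf
  rcases F.connected {f} (by
    rintro e f' g h1 - rfl
    simp [hf] at h1) with h | h
  · exact Set.singleton_ne_empty f h
  · have : Fintype.card Φ ≤ 1 := Fintype.card_le_one_iff.2 fun a b => by
      have ha : a ∈ ({f} : Set Φ) := h ▸ Set.mem_univ a
      have hb : b ∈ ({f} : Set Φ) := h ▸ Set.mem_univ b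
      rw [Set.mem_singleton_iff] at ha hb
      rw [ha, hb]
    omega

theorem three_le_card (h3 : 3 ≤ Fintype.card Φ) (f : Φ) : 3 ≤ (F.bd f).card :=
  (F.even_bd f).three_le_card (F.bd_subset f) (F.bd_nonempty h3 f)

/-- Two faces with the same boundary occupy both sides of all its edges, so no third face can be
reached from them. -/
theorem bd_injective (h3 : 3 ≤ Fintype.card Φ) : Function.Injective F.bd := by
  intro f g hfg
  by_contra hne
  obtain ⟨e, he⟩ := F.bd_nonempty h3 f
  rcases F.connected {f, g} (by
    rintro e f' g' h1 h2 h
    have h4 : e ∈ F.bd f := by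
      rcases h with rfl | rfl
      · exact h1
      · rw [hfg]; exact h1
    exact F.two_faces h4 (hfg ▸ h4) hne h2) with h | h
  · exact (Set.insert_nonempty _ _).ne_empty h
  · have h1 : Fintype.card Φ = ({f, g} : Finset Φ).card := by
      rw [← Finset.card_univ]
      congr 1
      rw [← Finset.coe_inj]
      simp [h]
    have := Finset.card_le_two (a := f) (b := g)
    omega

theorem cyc_spec (h3 : 3 ≤ Fintype.card Φ) {f : Φ} (hf : (F.bd f).card ≤ 4) :
    IsCycleSubgraph (F.cyc f) (F.bd f).card ∧ (F.cyc f).edgeSet = F.bd f := by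
  have h := (F.even_bd f).exists_cycle_of_card_le (F.bd_subset f) (F.bd_nonempty h3 f) (by omega)
  rw [cyc, dif_pos h]
  exact h.choose_spec

/-- The faces of the path from `T` to `f`, read backwards after `C`, form the required sequence. The
induction quantifies over `C` because the cycle of the last face takes its role in the shorter path.
-/
theorem dependentCycles_cyc (h3 : 3 ≤ Fintype.card Φ) {T f : Φ} (hT : (F.bd T).card = 3)
    (h : F.Reach T f) : ∀ (C : G.Subgraph) (i : ℕ), IsCycleSubgraph C i →
      (∃ e ∈ F.bd f, e ∈ C.edgeSet) → DependentCycles C (F.cyc T) := by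
  have hT' := F.cyc_spec h3 (f := T) (by omega)
  induction h with
  | refl =>
    rintro C i hC ⟨e, he, heC⟩
    refine ⟨⟨i, hC⟩, ⟨_, hT'.1⟩, 1, fun n => if n = 0 then C else F.cyc T, by simp, by simp, ?_, ?_⟩
    · intro l hl
      obtain rfl : l = 0 := by omega
      refine ⟨e, by simpa using heC, ?_⟩
      simpa [hT'.2] using he
    · intro s; omega
  | tail _ hab ih =>
    rename_i a b _
    rintro C i hC ⟨e, he, heC⟩
    obtain ⟨hb, e', hea, heb⟩ := hab
    have hb' := F.cyc_spec h3 (f := b) (by omega)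
    obtain ⟨-, -, t, S, hS0, hSt, hS1, hS4⟩ := ih (F.cyc b) _ hb'.1
      ⟨e', hea, by rw [hb'.2]; exact heb⟩
    refine ⟨⟨i, hC⟩, ⟨_, hT'.1⟩, t + 1, fun n => if n = 0 then C else S (n - 1), by simp,
      by simpa using hSt, ?_, ?_⟩
    · intro l hl
      rcases Nat.eq_zero_or_pos l with rfl | hl0
      · refine ⟨e, by simpa using heC, ?_⟩
        simpa [hS0, hb'.2] using he
      · have := hS1 (l - 1) (by omega)
        rw [Nat.sub_add_cancel hl0] at this
        simpa [hl0.ne'] using this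
    · intro s hs hst
      have hs0 : s ≠ 0 := by omega
      simp only [hs0, if_false]
      rcases Nat.eq_zero_or_pos (s - 1) with h0 | h0
      · rw [h0, hS0, ← hb]; exact hb'.1
      · exact hS4 _ h0 (by omega)

/-! ### Discharging. -/

section Bounds

variable (h3 : 3 ≤ Fintype.card Φ)
  (hsmall : ∀ (i : ℕ) (C : G.Subgraph), 3 ≤ i → i ≤ 5 → IsCycleSubgraph C i →
    (dependentTriangles C).ncard ≤ i - 3)
  (hlarge : ∀ (i : ℕ) (C : G.Subgraph), 6 ≤ i → IsCycleSubgraph C i →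
    (dependentTriangles C).ncard ≤ i - 2)

include h3 hsmall

omit hsmall in
-- Different triangular faces give different 3-cycles dependent with `C`. The summand 1 is for `C`
-- itself, which `dependentTriangles` leaves out.
theorem card_triangles_le {C : G.Subgraph} {A : Finset (Sym2 V)}
    (hC : IsCycleSubgraph C A.card) (hA : C.edgeSet = A) :
    (F.triangles A).card ≤ (dependentTriangles C).ncard + if A.card = 3 then 1 else 0 := by
  have hinj : Set.InjOn F.cyc (F.triangles A) := by
    intro T hT T' hT' h
    rw [mem_coe, mem_triangles] at hT hT'
    have h1 := (F.cyc_spec h3 (f := T) (by omega)).2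
    have h2 := (F.cyc_spec h3 (f := T') (by omega)).2
    apply F.bd_injective h3
    rw [← coe_inj, ← h1, ← h2, h]
  rw [← Set.ncard_coe_finset, ← hinj.ncard_image]
  have hmem : ∀ T ∈ F.triangles A, F.cyc T ≠ C → F.cyc T ∈ dependentTriangles C := by
    intro T hT hne
    rw [mem_triangles] at hT
    obtain ⟨hT, f, hf, e, heA, hef⟩ := hT
    have h1 := (F.cyc_spec h3 (f := T) (by omega)).1
    rw [hT] at h1
    exact ⟨h1, hne, F.dependentCycles_cyc h3 hT hf C _ hC ⟨e, hef, by rw [hA]; exact heA⟩⟩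
  split_ifs with h
  · refine le_trans (Set.ncard_le_ncard (t := insert C (dependentTriangles C)) ?_
      (Set.toFinite _)) (Set.ncard_insert_le _ _)
    rintro _ ⟨T, hT, rfl⟩
    by_cases hTC : F.cyc T = C
    · exact Or.inl hTC
    · exact Or.inr (hmem T hT hTC)
  · refine Set.ncard_le_ncard ?_ (Set.toFinite _)
    rintro _ ⟨T, hT, rfl⟩
    refine hmem T hT ?_
    rintro rfl
    rw [mem_coe, mem_triangles] at hT
    have h1 := (F.cyc_spec h3 (f := T) (by omega)).2
    rw [hA, coe_inj] at h1
    rw [h1] at h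
    exact h hT.1

/-- For three edges the bound is 0 + 1, the face itself being counted; for four edges it is 1 + 0.
-/
theorem eq_of_mem_triangles_bd {f T T' : Φ} (hf : (F.bd f).card ≤ 4)
    (hT : T ∈ F.triangles (F.bd f)) (hT' : T' ∈ F.triangles (F.bd f)) : T = T' := by
  have h1 := F.cyc_spec h3 hf
  have h2 := F.card_triangles_le h3 h1.1 h1.2
  have h4 := F.three_le_card h3 f
  have h5 := hsmall _ _ h4 (by omega) h1.1
  refine Finset.card_le_one.1 ?_ T hT T' hT'
  split_ifs at h2 <;> omega

include hlarge

/-- The number of triangles is at most 1, 1, 2 for lengths 3, 4, 5 and at most i - 2 for i ≥ 6. The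
constant 5 is sharp for i = 3, the constant 8 for i = 5 and i = 6. -/
theorem card_triangles_cycle {C : G.Subgraph} {A : Finset (Sym2 V)}
    (hC : IsCycleSubgraph C A.card) (hA : C.edgeSet = A) :
    (F.triangles A).card + 5 ≤ 2 * A.card ∧
      (5 ≤ A.card → (F.triangles A).card + 8 ≤ 2 * A.card) := by
  have h1 := F.card_triangles_le h3 hC hA
  have h2 := (even_of_isCycleSubgraph hC hA).2.2
  by_cases h6 : 6 ≤ A.card
  · have := hlarge _ _ h6 hC
    split_ifs at h1 <;> omega
  · have := hsmall _ _ h2 (by omega) hC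
    split_ifs at h1 <;> omega

/-- Split off a cycle and induct: triangles are subadditive, and two pieces together have slack 5 +
5, more than the 8 needed. -/
theorem card_triangles_even {B : Finset (Sym2 V)} (hB : EvenEdges B)
    (hG : (B : Set (Sym2 V)) ⊆ G.edgeSet) (hne : B.Nonempty) :
    (F.triangles B).card + 5 ≤ 2 * B.card ∧
      (5 ≤ B.card → (F.triangles B).card + 8 ≤ 2 * B.card) := by
  induction hn : B.card using Nat.strong_induction_on generalizing B with
  | _ n ih =>
  subst hn
  obtain ⟨C, A, hAB, hC, hA⟩ := hB.exists_cycle hG hne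
  have h1 := F.card_triangles_cycle h3 hsmall hlarge hC hA
  have h2 := even_of_isCycleSubgraph hC hA
  by_cases hBA : B \ A = ∅
  · have : A = B := hAB.antisymm (Finset.sdiff_eq_empty_iff_subset.1 hBA)
    subst this
    exact h1
  · have h4 := Finset.card_sdiff_add_card_eq_card hAB
    have h5 := ih (B \ A).card (by omega) (h2.1.sdiff hB hAB)
      ((Finset.coe_subset.2 Finset.sdiff_subset).trans hG) (Finset.nonempty_iff_ne_empty.2 hBA) rfl
    have h6 : F.triangles B = F.triangles (B \ A) ∪ F.triangles A := by
      rw [← triangles_union, sdiff_union_of_subset hAB]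
    have h7 := card_union_le (F.triangles (B \ A)) (F.triangles A)
    rw [h6]
    omega

omit h3 hsmall hlarge

/-- The edges that lie on an odd number of faces from `K`. -/
noncomputable def oddEdges (K : Finset Φ) : Finset (Sym2 V) :=
  univ.filter fun e => Odd (K.filter fun f => e ∈ F.bd f).card

omit [Fintype Φ] in
-- Count by edges: an edge contributes the number of its faces in `K`, plus one exactly if that
-- number is odd. Taking for `p` incidence with a vertex gives evenness of the border; taking `True`
-- gives its parity in total.
theorem even_sum_add_card_oddEdges (K : Finset Φ) (p : Sym2 V → Prop) :
    Even (∑ f ∈ K, ((F.bd f).filter p).card + ((F.oddEdges K).filter p).card) := by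
  have h1 : ∑ f ∈ K, ((F.bd f).filter p).card =
      ∑ e : Sym2 V, if p e then (K.filter fun f => e ∈ F.bd f).card else 0 := by
    simp only [Finset.card_filter]
    have : ∀ f ∈ K, (∑ e ∈ F.bd f, if p e then 1 else 0) =
        ∑ e : Sym2 V, if p e then (if e ∈ F.bd f then 1 else 0) else 0 := by
      intro f _
      rw [← Finset.sum_filter, ← Finset.sum_filter, ← Finset.sum_filter]
      congr 1
      ext e; simp [and_comm]
    rw [Finset.sum_congr rfl this, Finset.sum_comm]
    refine Finset.sum_congr rfl fun e _ => ?_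
    split_ifs <;> simp
  have h2 : ((F.oddEdges K).filter p).card =
      ∑ e : Sym2 V, if p e then (if Odd (K.filter fun f => e ∈ F.bd f).card then 1 else 0) else 0 := by
    rw [oddEdges, Finset.filter_filter, Finset.card_filter]
    refine Finset.sum_congr rfl fun e _ => ?_
    split_ifs <;> simp_all
  rw [h1, h2, ← Finset.sum_add_distrib]
  refine Finset.even_sum _ fun e _ => ?_
  split_ifs with h h'
  · exact h'.add_odd odd_one
  · simpa using h'
  · simp

omit [Fintype Φ] in
theorem mem_oddEdges {K : Finset Φ} {e : Sym2 V} :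
    e ∈ F.oddEdges K ↔ ∃ f ∈ K, e ∈ F.bd f ∧ ∃ g, g ∉ K ∧ e ∈ F.bd g := by
  simp only [oddEdges, mem_filter, mem_univ, true_and]
  constructor
  · intro h
    obtain ⟨f, hf⟩ := Finset.card_pos.1 h.pos
    rw [mem_filter] at hf
    obtain ⟨g, hgf, hg⟩ := F.exists_other f e hf.2
    refine ⟨f, hf.1, hf.2, g, fun hgK => ?_, (hg g).2 (Or.inr rfl)⟩
    have : (K.filter fun f => e ∈ F.bd f) = {f, g} := by
      ext k
      simp only [mem_filter, mem_insert, mem_singleton, hg]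
      grind
    rw [this, Finset.card_pair hgf.symm] at h
    exact absurd h (by decide)
  · rintro ⟨f, hf, hef, g, hg, heg⟩
    have : (K.filter fun f => e ∈ F.bd f) = {f} := by
      ext k
      simp only [mem_filter, mem_singleton]
      constructor
      · rintro ⟨hk, hek⟩
        rcases F.two_faces hef heg (by rintro rfl; exact hg hf) hek with h | h
        · exact h
        · exact absurd (h ▸ hk) hg
      · rintro rfl
        exact ⟨hf, hef⟩
    rw [this]
    simp

/-- The cluster of a face: all faces reachable from it through faces with four edges. -/
noncomputable def cluster (T : Φ) : Finset Φ := univ.filter fun f => F.Reach T f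

theorem mem_cluster {T f : Φ} : f ∈ F.cluster T ↔ F.Reach T f := by simp [cluster]

omit [Fintype Φ] in
theorem evenEdges_oddEdges (K : Finset Φ) : EvenEdges (F.oddEdges K) := by
  intro v
  have h1 := F.even_sum_add_card_oddEdges K (fun e => v ∈ e)
  have h2 : Even (∑ f ∈ K, ((F.bd f).filter fun e => v ∈ e).card) :=
    Finset.even_sum _ fun f _ => F.even_bd f v
  have h3 := (Nat.even_add.1 h1).1 (by convert h2)
  convert h3

/-- The face sizes in the cluster are one 3 and otherwise 4, so their sum is odd and so is the size
of the border. -/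
theorem oddEdges_cluster_nonempty {T : Φ} (hT : (F.bd T).card = 3) :
    (F.oddEdges (F.cluster T)).Nonempty := by
  have h1 := F.even_sum_add_card_oddEdges (F.cluster T) (fun _ => True)
  simp only [filter_true] at h1
  have hTK : T ∈ F.cluster T := F.mem_cluster.2 Relation.ReflTransGen.refl
  rw [← Finset.add_sum_erase _ _ hTK, hT] at h1
  have h2 : Even (∑ f ∈ (F.cluster T).erase T, (F.bd f).card) := by
    refine Finset.even_sum _ fun f hf => ?_
    rw [mem_erase, mem_cluster] at hf
    rw [(hf.2.quad).resolve_left hf.1]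
    decide
  rw [← Finset.card_pos]
  rcases Nat.eq_zero_or_pos (F.oddEdges (F.cluster T)).card with h | h
  · rw [h] at h1
    grind
  · exact h

omit [Fintype Φ] in
theorem oddEdges_subset_edgeSet (K : Finset Φ) : (F.oddEdges K : Set (Sym2 V)) ⊆ G.edgeSet := by
  intro e he
  rw [mem_coe, mem_oddEdges] at he
  obtain ⟨f, -, hf, -⟩ := he
  exact F.bd_subset f hf

theorem mem_triangles_bd_self (h3 : 3 ≤ Fintype.card Φ) {T : Φ} (hT : (F.bd T).card = 3) :
    T ∈ F.triangles (F.bd T) := by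
  obtain ⟨e, he⟩ := F.bd_nonempty h3 T
  exact F.mem_triangles.2 ⟨hT, T, Relation.ReflTransGen.refl, e, he, he⟩

include h3 hsmall

/-- A neighbour with four edges would belong to the cluster; one with three edges would be a second
triangle at its own boundary besides `T`. -/
theorem big_of_mem_oddEdges_cluster {T f g : Φ} {e : Sym2 V} (hT : (F.bd T).card = 3)
    (hf : F.Reach T f) (hef : e ∈ F.bd f) (hg : ¬ F.Reach T g) (heg : e ∈ F.bd g) :
    5 ≤ (F.bd g).card ∧ T ∈ F.triangles (F.bd g) := by
  have hT' : T ∈ F.triangles (F.bd g) := F.mem_triangles.2 ⟨hT, f, hf, e, heg, hef⟩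
  refine ⟨?_, hT'⟩
  have h1 := F.three_le_card h3 g
  by_contra h5
  by_cases h4 : (F.bd g).card = 4
  · exact hg (Relation.ReflTransGen.tail hf ⟨h4, e, hef, heg⟩)
  · have h6 : (F.bd g).card = 3 := by omega
    have := F.eq_of_mem_triangles_bd h3 hsmall (by omega) hT' (F.mem_triangles_bd_self h3 h6)
    subst this
    exact hg Relation.ReflTransGen.refl

theorem eq_of_reach_of_reach {T T' f : Φ} (hT : (F.bd T).card = 3) (hT' : (F.bd T').card = 3)
    (hf : F.Reach T f) (hf' : F.Reach T' f) : T = T' := by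
  have hf4 : (F.bd f).card ≤ 4 := by
    rcases hf.quad with rfl | h <;> omega
  obtain ⟨e, he⟩ := F.bd_nonempty h3 f
  exact F.eq_of_mem_triangles_bd h3 hsmall hf4 (F.mem_triangles.2 ⟨hT, f, hf, e, he, he⟩)
    (F.mem_triangles.2 ⟨hT', f, hf', e, he, he⟩)

omit h3 hsmall

/-- The faces with three edges whose cluster has `g` as its only neighbour with at least five
edges. -/
noncomputable def captive (g : Φ) : Finset Φ :=
  (F.triangles (F.bd g)).filter fun T =>
    ∀ h, 5 ≤ (F.bd h).card → T ∈ F.triangles (F.bd h) → h = g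

include h3 hsmall

theorem oddEdges_subset_of_mem_captive {T g : Φ} (hT : T ∈ F.captive g) :
    F.oddEdges (F.cluster T) ⊆ F.bd g := by
  intro e he
  rw [captive, mem_filter] at hT
  obtain ⟨f, hf, hef, h, hh, heh⟩ := F.mem_oddEdges.1 he
  rw [mem_cluster] at hf hh
  have h1 := F.big_of_mem_oddEdges_cluster h3 hsmall (F.mem_triangles.1 hT.1).1 hf hef hh heh
  rw [← hT.2 h h1.1 h1.2]
  exact heh

/-- A common border edge has `g` on one side, so the face on its other side would belong to both
clusters. -/
theorem disjoint_oddEdges_cluster {T T' g : Φ} (hg : 5 ≤ (F.bd g).card) (hT : T ∈ F.captive g)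
    (hT' : T' ∈ F.captive g) (hne : T ≠ T') :
    Disjoint (F.oddEdges (F.cluster T)) (F.oddEdges (F.cluster T')) := by
  rw [Finset.disjoint_left]
  intro e he he'
  have heg := F.oddEdges_subset_of_mem_captive h3 hsmall hT he
  obtain ⟨f, hf, hef, -⟩ := F.mem_oddEdges.1 he
  obtain ⟨f', hf', hef', -⟩ := F.mem_oddEdges.1 he'
  rw [mem_cluster] at hf hf'
  rw [captive, mem_filter, mem_triangles] at hT hT'
  have hfg : g ≠ f := by
    rintro rfl
    rcases hf.quad with h | h
    · rw [h] at hg; omega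
    · omega
  have hfg' : f' ≠ g := by
    rintro rfl
    rcases hf'.quad with h | h
    · rw [h] at hg; omega
    · omega
  have := (F.two_faces heg hef hfg hef').resolve_left hfg'
  subst this
  exact hne (F.eq_of_reach_of_reach h3 hsmall hT.1.1 hT'.1.1 hf hf')

omit h3 hsmall in
theorem triangles_bd_of_oddEdges_eq {T g : Φ} (hg : 5 ≤ (F.bd g).card) (hT : (F.bd T).card = 3)
    (h : F.oddEdges (F.cluster T) = F.bd g) : F.triangles (F.bd g) ⊆ {T} := by
  have hgK : ¬ F.Reach T g := by
    intro hr
    rcases hr.quad with h | h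
    · rw [h] at hg; omega
    · omega
  -- All border edges of the cluster lead to `g`, and all edges of `g` lead to the cluster, so these
  -- faces form a closed class.
  have huniv : insert g {f | F.Reach T f} = Set.univ := by
    refine (F.connected _ ?_).resolve_left (Set.insert_nonempty _ _).ne_empty
    intro e f k hef hek hf
    by_cases hk : F.Reach T k
    · exact Or.inr hk
    · left
      rcases hf with rfl | hf
      · rw [← h, mem_oddEdges] at hef
        obtain ⟨f', hf', hef', -⟩ := hef
        rw [mem_cluster] at hf'
        have heg : e ∈ F.bd f := by
          rw [← h, mem_oddEdges]
          exact ⟨f', F.mem_cluster.2 hf', hef', k, fun hk' => hk (F.mem_cluster.1 hk'), hek⟩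
        rcases F.two_faces heg hef' (by rintro rfl; exact hgK hf') hek with h | h
        · exact h
        · exact absurd (h ▸ hf') hk
      · have heg : e ∈ F.bd g := by
          rw [← h, mem_oddEdges]
          exact ⟨f, F.mem_cluster.2 hf, hef, k, fun hk' => hk (F.mem_cluster.1 hk'), hek⟩
        rcases F.two_faces heg hef (by rintro rfl; exact hgK hf) hek with h | h
        · exact h
        · rw [h] at hk; exact absurd hf hk
  intro T' hT'
  rw [mem_triangles] at hT'
  have h1 : T' ∈ insert g {f | F.Reach T f} := huniv ▸ Set.mem_univ T'
  rw [mem_singleton]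
  rcases h1 with rfl | h1
  · omega
  · rcases Reach.quad F h1 with h | h
    · exact h
    · omega

include hlarge

theorem card_triangles_add_card_captive {g : Φ} (hg : 5 ≤ (F.bd g).card) :
    (F.triangles (F.bd g)).card + (F.captive g).card + 8 ≤ 2 * (F.bd g).card := by
  have hbd := F.card_triangles_even h3 hsmall hlarge (F.even_bd g) (F.bd_subset g)
    (F.bd_nonempty h3 g)
  rcases Nat.eq_zero_or_pos (F.captive g).card with h0 | h0
  · have := hbd.2 hg
    omega
  set B : Φ → Finset (Sym2 V) := fun T => F.oddEdges (F.cluster T) with hBdef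
  set U := (F.captive g).biUnion B with hU
  have hcap3 : ∀ T ∈ F.captive g, (F.bd T).card = 3 := by
    intro T hT
    rw [captive, mem_filter, mem_triangles] at hT
    exact hT.1.1
  have hdisj : ((F.captive g : Finset Φ) : Set Φ).PairwiseDisjoint B := fun T hT T' hT' hne =>
    F.disjoint_oddEdges_cluster h3 hsmall hg hT hT' hne
  have hUsub : U ⊆ F.bd g := by
    rw [hU, Finset.biUnion_subset]
    exact fun T hT => F.oddEdges_subset_of_mem_captive h3 hsmall hT
  have hUeven : EvenEdges U := EvenEdges.biUnion _ _ (fun T _ => F.evenEdges_oddEdges _) hdisj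
  have hUcard : (F.triangles U).card + 5 * (F.captive g).card ≤ 2 * U.card := by
    have h1 : (F.triangles U).card ≤ ∑ T ∈ F.captive g, (F.triangles (B T)).card := by
      rw [hU, triangles_biUnion]
      exact Finset.card_biUnion_le
    have h2 : U.card = ∑ T ∈ F.captive g, (B T).card := Finset.card_biUnion hdisj
    have h4 : ∑ T ∈ F.captive g, ((F.triangles (B T)).card + 5) ≤
        ∑ T ∈ F.captive g, 2 * (B T).card := Finset.sum_le_sum fun T hT =>
      (F.card_triangles_even h3 hsmall hlarge (F.evenEdges_oddEdges _)
        (F.oddEdges_subset_edgeSet _) (F.oddEdges_cluster_nonempty (hcap3 T hT))).1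
    rw [Finset.sum_add_distrib, ← Finset.mul_sum, Finset.sum_const, smul_eq_mul, ← h2] at h4
    omega
  -- Each captive brings slack 5 and costs 1. Two captives leave 8; one captive and a nonempty
  -- remainder leave 4 + 5.
  by_cases hrest : F.bd g \ U = ∅
  · have hUeq : U = F.bd g := hUsub.antisymm (Finset.sdiff_eq_empty_iff_subset.1 hrest)
    by_cases h2 : 2 ≤ (F.captive g).card
    · rw [← hUeq]
      omega
    -- The slack 4 of a single captive is too small, but then `g` and one cluster are all the faces,
    -- so both counts are 1 and |bd g| ≥ 5 suffices.
    · have h1 : (F.captive g).card = 1 := by omega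
      obtain ⟨T, hT⟩ := Finset.card_eq_one.1 h1
      have h5 : F.oddEdges (F.cluster T) = F.bd g := by
        rw [← hUeq, hU, hT, singleton_biUnion]
      have h6 := Finset.card_le_card (F.triangles_bd_of_oddEdges_eq hg
        (hcap3 T (by rw [hT]; exact mem_singleton_self T)) h5)
      rw [card_singleton] at h6
      omega
  · have h5 := (F.card_triangles_even h3 hsmall hlarge (hUeven.sdiff (F.even_bd g) hUsub)
      ((Finset.coe_subset.2 Finset.sdiff_subset).trans (F.bd_subset g))
      (Finset.nonempty_iff_ne_empty.2 hrest)).1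
    have h4 := Finset.card_sdiff_add_card_eq_card hUsub
    have h6 : F.triangles (F.bd g) = F.triangles (F.bd g \ U) ∪ F.triangles U := by
      rw [← triangles_union, sdiff_union_of_subset hUsub]
    have h7 := card_union_le (F.triangles (F.bd g \ U)) (F.triangles U)
    rw [← h6] at h7
    omega

omit hlarge

theorem two_mul_card_le_sum :
    2 * (univ.filter fun T => (F.bd T).card = 3).card ≤
      ∑ g ∈ univ.filter (fun g => 5 ≤ (F.bd g).card),
        ((F.triangles (F.bd g)).card + (F.captive g).card) := by
  set Tr := univ.filter fun T => (F.bd T).card = 3 with hTr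
  set Bg := univ.filter (fun g => 5 ≤ (F.bd g).card) with hBg
  have h1 : ∀ g, (F.triangles (F.bd g)).card =
      ∑ T ∈ Tr, if T ∈ F.triangles (F.bd g) then 1 else 0 := by
    intro g
    rw [← Finset.card_filter]
    congr 1
    ext T
    simp only [hTr, mem_filter, mem_univ, true_and]
    exact ⟨fun h => ⟨(F.mem_triangles.1 h).1, h⟩, fun h => h.2⟩
  have h2 : ∀ g, (F.captive g).card = ∑ T ∈ Tr, if T ∈ F.captive g then 1 else 0 := by
    intro g
    rw [← Finset.card_filter]
    congr 1
    ext T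
    simp only [hTr, mem_filter, mem_univ, true_and]
    refine ⟨fun h => ⟨?_, h⟩, fun h => h.2⟩
    rw [captive, mem_filter] at h
    exact (F.mem_triangles.1 h.1).1
  simp only [h1, h2, ← Finset.sum_add_distrib]
  rw [Finset.sum_comm, mul_comm, ← smul_eq_mul, ← Finset.sum_const]
  refine Finset.sum_le_sum fun T hT => ?_
  have hT3 : (F.bd T).card = 3 := (mem_filter.1 hT).2
  obtain ⟨e, he⟩ := F.oddEdges_cluster_nonempty hT3
  obtain ⟨f, hf, hef, g, hg, heg⟩ := F.mem_oddEdges.1 he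
  rw [mem_cluster] at hf hg
  obtain ⟨hg5, hTg⟩ := F.big_of_mem_oddEdges_cluster h3 hsmall hT3 hf hef hg heg
  rw [Finset.sum_add_distrib, ← Finset.card_filter, ← Finset.card_filter]
  have hgm : g ∈ Bg.filter fun g => T ∈ F.triangles (F.bd g) := by simp [hBg, hg5, hTg]
  -- If `g` is the only big neighbour, `T` is captive there and counts in both terms; otherwise two
  -- big faces count it.
  by_cases huniq : ∀ h, 5 ≤ (F.bd h).card → T ∈ F.triangles (F.bd h) → h = g
  · have h4 : g ∈ Bg.filter fun g => T ∈ F.captive g := by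
      simp only [mem_filter, hBg, mem_univ, true_and, captive]
      exact ⟨hg5, hTg, huniq⟩
    have := Finset.card_pos.2 ⟨g, hgm⟩
    have := Finset.card_pos.2 ⟨g, h4⟩
    omega
  · push Not at huniq
    obtain ⟨h, hh5, hTh, hne⟩ := huniq
    have : 1 < (Bg.filter fun g => T ∈ F.triangles (F.bd g)).card :=
      Finset.one_lt_card.2 ⟨g, hgm, h, by simp [hBg, hh5, hTh], hne.symm⟩
    omega

include hlarge

theorem four_mul_card_le_sum : 4 * Fintype.card Φ ≤ ∑ f, (F.bd f).card := by
  -- All charges are doubled: a triangle needs 2, a face with four edges is balanced, and a big face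
  -- pays one unit per count.
  have h1 : ∀ f, 8 + (if 5 ≤ (F.bd f).card then
      ((F.triangles (F.bd f)).card + (F.captive f).card) else 0) ≤
      2 * (F.bd f).card + if (F.bd f).card = 3 then 2 else 0 := by
    intro f
    have h4 := F.three_le_card h3 f
    by_cases h5 : 5 ≤ (F.bd f).card
    · have := F.card_triangles_add_card_captive h3 hsmall hlarge h5
      rw [if_pos h5]
      omega
    · rw [if_neg h5]
      split_ifs <;> omega
  have h2 := Finset.sum_le_sum fun f (_ : f ∈ (univ : Finset Φ)) => h1 f
  rw [Finset.sum_add_distrib, Finset.sum_add_distrib, ← Finset.sum_filter, ← Finset.sum_filter,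
    ← Finset.mul_sum, Finset.sum_const, Finset.sum_const, smul_eq_mul, smul_eq_mul, card_univ] at h2
  have h4 := F.two_mul_card_le_sum h3 hsmall
  omega

omit h3

include F in
/-- The face count for a system of faces in which triangles depend on few cycles. -/
theorem card_add_two_le (hV : 4 ≤ Fintype.card V) : Fintype.card Φ + 2 ≤ Fintype.card V := by
  by_cases h3 : 3 ≤ Fintype.card Φ
  · have h1 := F.four_mul_card_le_sum h3 hsmall hlarge
    have h2 : ∑ f, (F.bd f).card = 2 * (univ.filter fun e => ∃ f, e ∈ F.bd f).card := by
      have h4 : ∀ f, (F.bd f).card =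
          ∑ e ∈ univ.filter (fun e => ∃ f, e ∈ F.bd f), if e ∈ F.bd f then 1 else 0 := by
        intro f
        rw [← Finset.card_filter]
        congr 1
        ext e
        simp only [mem_filter, mem_univ, true_and]
        exact ⟨fun h => ⟨⟨f, h⟩, h⟩, fun h => h.2⟩
      simp only [h4]
      rw [Finset.sum_comm, mul_comm, ← smul_eq_mul, ← Finset.sum_const]
      refine Finset.sum_congr rfl fun e he => ?_
      obtain ⟨f, hf⟩ := (mem_filter.1 he).2
      obtain ⟨g, hgf, hg⟩ := F.exists_other f e hf
      rw [← Finset.card_filter, ← Finset.card_pair hgf.symm]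
      congr 1
      ext h
      simp [hg]
    have h4 := F.ncard_le
    have h5 : {e | ∃ f, e ∈ F.bd f} = (univ.filter fun e => ∃ f, e ∈ F.bd f : Finset _) := by
      ext e
      simp
    rw [Nat.card_eq_fintype_card, h5, Set.ncard_coe_finset] at h4
    omega
  · omega

end Bounds

end Finite

end FaceSystem

/-! ### Directions and polygonal arcs near a point. -/

open Filter Topology

/-- The direction in which the point `z` is seen from `x`. -/
noncomputable def dir (x z : ℂ) : Real.Angle := ((z - x).arg : ℝ)

theorem dir_add_exp (x s : ℂ) : dir x (x + Complex.exp s) = (s.im : Real.Angle) := by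
  rw [dir, add_sub_cancel_left, Complex.arg_exp, Real.Angle.coe_toIocMod]

theorem dir_eq_iff {x y z : ℂ} (hy : y ≠ x) (hz : z ≠ x) :
    dir x y = dir x z ↔ SameRay ℝ (y - x) (z - x) := by
  rw [dir, dir, Complex.arg_coe_angle_eq_iff, Complex.sameRay_iff]
  simp [sub_eq_zero, hy, hz]

theorem tendsto_add_exp (x : ℂ) (θ : ℝ) :
    Tendsto (fun l : ℝ => x + Complex.exp (l + θ * Complex.I)) atBot (𝓝[≠] x) := by
  rw [tendsto_nhdsWithin_iff]
  refine ⟨?_, Eventually.of_forall fun l => by simp [Complex.exp_ne_zero]⟩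
  have h1 : Tendsto (fun l : ℝ => Complex.exp (l + θ * Complex.I)) atBot (𝓝 0) := by
    rw [tendsto_zero_iff_norm_tendsto_zero]
    simpa [Complex.norm_exp] using Real.tendsto_exp_atBot
  simpa using h1.const_add x

theorem frequently_dir_eq (x : ℂ) (a : Real.Angle) : ∃ᶠ z in 𝓝[≠] x, dir x z = a := by
  induction a using Real.Angle.induction_on with
  | _ θ =>
  refine (tendsto_add_exp x θ).frequently (Eventually.frequently (Eventually.of_forall fun l => ?_))
  rw [dir_add_exp]
  simp

theorem eventually_mem_segment_iff {p q : ℂ} (hpq : p ≠ q) :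
    ∀ᶠ z in 𝓝[≠] p, z ∈ segment ℝ p q ↔ dir p z = dir p q := by
  have h1 : ∀ᶠ z in 𝓝[≠] p, ‖z - p‖ < ‖q - p‖ := by
    refine nhdsWithin_le_nhds ?_
    have : Continuous fun z : ℂ => ‖z - p‖ := by fun_prop
    refine this.continuousAt.eventually_lt continuousAt_const ?_
    simpa [sub_eq_zero] using hpq.symm
  filter_upwards [h1, self_mem_nhdsWithin] with z hz hzp
  have hzp' : z ≠ p := hzp
  rw [dir_eq_iff hzp' hpq.symm, segment_eq_image']
  constructor
  · rintro ⟨t, ht, rfl⟩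
    simp only [add_sub_cancel_left]
    exact SameRay.nonneg_smul_left (SameRay.refl _) ht.1
  · intro h
    obtain ⟨r, hr, hr'⟩ := h.exists_nonneg_right (sub_ne_zero.2 hpq.symm)
    refine ⟨r, ⟨hr, ?_⟩, by simp only [← hr']; ring⟩
    rw [hr', norm_smul, Real.norm_of_nonneg hr] at hz
    nlinarith [norm_nonneg (q - p)]

/-- An inner point cuts the segment into two segments that start there in opposite directions. -/
theorem eventually_mem_segment_iff_of_mem {p q x : ℂ} (hx : x ∈ segment ℝ p q) (hp : x ≠ p)
    (hq : x ≠ q) : dir x p ≠ dir x q ∧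
      ∀ᶠ z in 𝓝[≠] x, z ∈ segment ℝ p q ↔ dir x z = dir x p ∨ dir x z = dir x q := by
  have hx' := mem_segment_iff_sameRay.1 hx
  constructor
  · rw [Ne, dir_eq_iff hp.symm hq.symm]
    intro h
    have h2 : SameRay ℝ (p - x) (x - p) := h.trans hx'.symm (by
      intro h0
      exact absurd (sub_eq_zero.1 h0).symm hq)
    rw [← neg_sub x p] at h2
    exact hp (sub_eq_zero.1 (eq_zero_of_sameRay_self_neg h2.symm))
  · have hseg : segment ℝ p q = segment ℝ x p ∪ segment ℝ x q := by
      obtain ⟨t, ht, rfl⟩ := (segment_eq_image' ℝ p q) ▸ hx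
      ext z
      constructor
      · intro hz
        obtain ⟨s, hs, rfl⟩ := (segment_eq_image' ℝ p q) ▸ hz
        rcases le_total s t with hst | hst
        · left
          rw [segment_symm, mem_segment_iff_sameRay]
          simp only [add_sub_cancel_left, add_sub_add_left_eq_sub, ← sub_smul]
          exact (SameRay.nonneg_smul_left (SameRay.refl _) hs.1).nonneg_smul_right
            (sub_nonneg.2 hst)
        · right
          rw [mem_segment_iff_sameRay]
          have : q - (p + s • (q - p)) = (1 - s) • (q - p) := by
            rw [sub_smul, one_smul]; ring
          simp only [add_sub_add_left_eq_sub, ← sub_smul, this]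
          exact (SameRay.nonneg_smul_left (SameRay.refl _) (sub_nonneg.2 hst)).nonneg_smul_right
            (sub_nonneg.2 hs.2)
      · rintro (h | h)
        · exact (convex_segment p q).segment_subset hx (left_mem_segment _ _ _) h
        · exact (convex_segment p q).segment_subset hx (right_mem_segment _ _ _) h
    filter_upwards [eventually_mem_segment_iff hp, eventually_mem_segment_iff hq] with z h1 h2
    rw [hseg, Set.mem_union, h1, h2]

theorem isPreconnected_segment_diff_left {p q : ℂ} (hpq : p ≠ q) :
    IsPreconnected (segment ℝ p q \ {p}) := by
  have h : segment ℝ p q \ {p} = AffineMap.lineMap p q '' Set.Ioc (0 : ℝ) 1 := by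
    rw [← Set.Icc_sdiff_left, Set.image_sdiff (AffineMap.lineMap_injective ℝ hpq),
      segment_eq_image_lineMap]
    simp
  rw [h]
  exact isPreconnected_Ioc.image _ AffineMap.lineMap_continuous.continuousOn

theorem isPreconnected_segment_diff {p q : ℂ} (hpq : p ≠ q) :
    IsPreconnected (segment ℝ p q \ {p, q}) := by
  have h : segment ℝ p q \ {p, q} = AffineMap.lineMap p q '' Set.Ioo (0 : ℝ) 1 := by
    rw [← Set.Icc_sdiff_both, Set.image_sdiff (AffineMap.lineMap_injective ℝ hpq),
      segment_eq_image_lineMap, Set.image_pair]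
    simp
  rw [h]
  exact isPreconnected_Ioo.image _ AffineMap.lineMap_continuous.continuousOn

theorem eventually_notMem_of_isClosed {A : Set ℂ} (hA : IsClosed A) {x : ℂ} (hx : x ∉ A) :
    ∀ᶠ z in 𝓝[≠] x, z ∉ A :=
  nhdsWithin_le_nhds (hA.isOpen_compl.mem_nhds hx)

theorem isCompact_segment (p q : ℂ) : IsCompact (segment ℝ p q) := by
  rw [segment_eq_image_lineMap]
  exact isCompact_Icc.image AffineMap.lineMap_continuous

namespace IsPolygonalArc

variable {p q : ℂ} {A : Set ℂ}

theorem left_mem (h : IsPolygonalArc p q A) : p ∈ A := by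
  cases h with
  | single => exact left_mem_segment _ _ _
  | cons => exact Or.inl (left_mem_segment _ _ _)

theorem right_mem (h : IsPolygonalArc p q A) : q ∈ A := by
  induction h with
  | single => exact right_mem_segment _ _ _
  | cons p q r A hpq hA hmeet ih => exact Or.inr ih

theorem isCompact (h : IsPolygonalArc p q A) : IsCompact A := by
  induction h with
  | single p q hpq => exact isCompact_segment p q
  | cons p q r A hpq hA hmeet ih => exact (isCompact_segment p q).union ih

theorem isClosed (h : IsPolygonalArc p q A) : IsClosed A := h.isCompact.isClosed

theorem ne (h : IsPolygonalArc p q A) : p ≠ q := by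
  cases h with
  | single _ _ hpq => exact hpq
  | cons _ q' _ A hpq hA hmeet =>
    rintro rfl
    exact hpq (hmeet.subset ⟨left_mem_segment _ _ _, hA.right_mem⟩)

theorem exists_dir_left (h : IsPolygonalArc p q A) :
    ∃ a, ∀ᶠ z in 𝓝[≠] p, z ∈ A ↔ dir p z = a := by
  cases h with
  | single _ _ hpq => exact ⟨_, eventually_mem_segment_iff hpq⟩
  | cons _ q' _ A hpq hA hmeet =>
    refine ⟨dir p q', ?_⟩
    filter_upwards [eventually_mem_segment_iff hpq, eventually_notMem_of_isClosed hA.isClosed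
      (fun hp => hpq (hmeet.subset ⟨left_mem_segment _ _ _, hp⟩))] with z h1 h2
    simp [h1, h2]

theorem exists_dir_pair (h : IsPolygonalArc p q A) {x : ℂ} (hx : x ∈ A) (hxp : x ≠ p)
    (hxq : x ≠ q) : ∃ a b, a ≠ b ∧ ∀ᶠ z in 𝓝[≠] x, z ∈ A ↔ dir x z = a ∨ dir x z = b := by
  induction h with
  | single p q hpq => exact ⟨_, _, eventually_mem_segment_iff_of_mem hx hxp hxq⟩
  | cons p q r A hpq hA hmeet ih =>
    by_cases hq : x = q
    · subst hq
      obtain ⟨a, ha⟩ := hA.exists_dir_left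
      have hseg := eventually_mem_segment_iff hpq.symm
      rw [segment_symm] at hseg
      refine ⟨dir x p, a, ?_, ?_⟩
      -- If the two directions at a joint agreed, the segment and the rest of the arc would share
      -- points other than the joint.
      · rintro rfl
        obtain ⟨z, hz, h1, h2, h3⟩ := ((frequently_dir_eq x (dir x p)).and_eventually
          (ha.and (hseg.and self_mem_nhdsWithin))).exists
        exact h3 (hmeet.subset ⟨h2.2 hz, h1.2 hz⟩)
      · filter_upwards [ha, hseg] with z h1 h2
        rw [Set.mem_union, h1, h2]
    · by_cases hxs : x ∈ segment ℝ p q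
      · have hxA : x ∉ A := fun h => hq (hmeet.subset ⟨hxs, h⟩)
        obtain ⟨h1, h2⟩ := eventually_mem_segment_iff_of_mem hxs hxp hq
        refine ⟨_, _, h1, ?_⟩
        filter_upwards [h2, eventually_notMem_of_isClosed hA.isClosed hxA] with z h3 h4
        simp [h3, h4]
      · obtain ⟨a, b, hab, h1⟩ := ih (hx.resolve_left hxs) hq hxq
        refine ⟨a, b, hab, ?_⟩
        filter_upwards [h1, eventually_notMem_of_isClosed (isCompact_segment p q).isClosed hxs]
          with z h3 h4
        simp [h3, h4]

theorem isPreconnected_diff_right (h : IsPolygonalArc p q A) : IsPreconnected (A \ {q}) := by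
  induction h with
  | single p q hpq =>
    rw [segment_symm]
    exact isPreconnected_segment_diff_left hpq.symm
  | cons p q r A hpq hA hmeet ih =>
    have hr : r ∉ segment ℝ p q := fun hr => hA.ne.symm (hmeet.subset ⟨hr, hA.right_mem⟩)
    rw [Set.union_sdiff_distrib, Set.sdiff_singleton_eq_self hr]
    exact (convex_segment p q).isPreconnected.union q (right_mem_segment _ _ _)
      ⟨hA.left_mem, hA.ne⟩ ih

theorem isPreconnected_diff (h : IsPolygonalArc p q A) : IsPreconnected (A \ {p, q}) := by
  cases h with
  | single _ _ hpq => exact isPreconnected_segment_diff hpq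
  | cons _ q' _ A hpq hA hmeet =>
    have hr : q ∉ segment ℝ p q' := fun hr => hA.ne.symm (hmeet.subset ⟨hr, hA.right_mem⟩)
    have hp : p ∉ A := fun hp => hpq (hmeet.subset ⟨left_mem_segment _ _ _, hp⟩)
    have h1 : (segment ℝ p q' ∪ A) \ {p, q} = (segment ℝ p q' \ {p}) ∪ (A \ {q}) := by
      ext z
      simp only [Set.mem_sdiff, Set.mem_union, Set.mem_insert_iff, Set.mem_singleton_iff]
      grind
    rw [h1]
    exact (isPreconnected_segment_diff_left hpq).union q' ⟨right_mem_segment _ _ _, hpq.symm⟩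
      ⟨hA.left_mem, hA.ne⟩ hA.isPreconnected_diff_right

end IsPolygonalArc

/-! ### Complement components and sectors around a point. -/

/-- The connected components of the complement of a plane set. -/
def complementComponents (X : Set ℂ) : Set (Set ℂ) :=
  (fun x : ℂ => connectedComponentIn Xᶜ x) '' Xᶜ

/-- The components of the complement of `X` that have `y` in their closure. -/
def sides (X : Set ℂ) (y : ℂ) : Set (Set ℂ) :=
  {f | f ∈ complementComponents X ∧ y ∈ closure f}

section Components

variable {X : Set ℂ}

theorem component_mem {z : ℂ} (hz : z ∉ X) : connectedComponentIn Xᶜ z ∈ complementComponents X :=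
  ⟨z, hz, rfl⟩

theorem component_eq {f : Set ℂ} (hf : f ∈ complementComponents X) {z : ℂ} (hz : z ∈ f) :
    f = connectedComponentIn Xᶜ z := by
  obtain ⟨w, hw, rfl⟩ := hf
  exact connectedComponentIn_eq hz

theorem notMem_of_mem_component {f : Set ℂ} (hf : f ∈ complementComponents X) {z : ℂ}
    (hz : z ∈ f) : z ∉ X := by
  obtain ⟨w, hw, rfl⟩ := hf
  exact connectedComponentIn_subset _ _ hz

theorem component_nonempty {f : Set ℂ} (hf : f ∈ complementComponents X) : f.Nonempty := by
  obtain ⟨w, hw, rfl⟩ := hf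
  exact ⟨w, mem_connectedComponentIn hw⟩

theorem sides_of_notMem (hX : IsClosed X) {z : ℂ} (hz : z ∉ X) :
    sides X z = {connectedComponentIn Xᶜ z} := by
  ext f
  simp only [sides, Set.mem_ofPred_eq, Set.mem_singleton_iff]
  constructor
  · rintro ⟨hf, hzf⟩
    obtain ⟨w, hw, hwf⟩ := mem_closure_iff.1 hzf _ hX.isOpen_compl.connectedComponentIn
      (mem_connectedComponentIn hz)
    rw [component_eq hf hwf, connectedComponentIn_eq hw]
  · rintro rfl
    exact ⟨component_mem hz, subset_closure (mem_connectedComponentIn hz)⟩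

end Components

theorem eventually_coe_angle_notMem {Θ : Set Real.Angle} (hΘ : Θ.Finite) (α : ℝ) :
    ∀ᶠ θ : ℝ in 𝓝[≠] α, (θ : Real.Angle) ∉ Θ := by
  have h : ∀ a ∈ Θ, ∀ᶠ θ : ℝ in 𝓝[≠] α, (θ : Real.Angle) ≠ a := by
    intro a _
    by_cases ha : (α : Real.Angle) = a
    · subst ha
      have h1 : ∀ᶠ θ : ℝ in 𝓝[≠] α, |θ - α| < 2 * Real.pi := by
        refine nhdsWithin_le_nhds ?_
        have : Continuous fun θ : ℝ => |θ - α| := by fun_prop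
        refine this.continuousAt.eventually_lt continuousAt_const ?_
        simp [Real.pi_pos]
      filter_upwards [h1, self_mem_nhdsWithin] with θ h2 h3 h4
      obtain ⟨k, hk⟩ := Real.Angle.angle_eq_iff_two_pi_dvd_sub.1 h4
      rw [hk, abs_mul, abs_of_pos Real.two_pi_pos] at h2
      have h5 : |(k : ℝ)| < 1 := by
        by_contra h
        nlinarith [Real.two_pi_pos]
      have h6 : k = 0 := by
        rw [← Int.abs_lt_one_iff]
        exact_mod_cast h5
      apply h3
      rw [h6] at hk
      simp only [Int.cast_zero, mul_zero, sub_eq_zero] at hk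
      exact hk
    · exact nhdsWithin_le_nhds (Real.Angle.continuous_coe.continuousAt.eventually_ne ha)
  filter_upwards [(eventually_all_finite hΘ).2 h] with θ h1 h2
  exact h1 _ h2 rfl

/-- Near `x`, the set `X` consists of the rays from `x` in the directions from `Θ`: for the points
`x + exp s` with `s.re < L` membership in `X` is decided by `s.im`. -/
def IsStar (X : Set ℂ) (x : ℂ) (Θ : Set Real.Angle) (L : ℝ) : Prop :=
  ∀ s : ℂ, s.re < L → (x + Complex.exp s ∈ X ↔ (s.im : Real.Angle) ∈ Θ)

theorem exists_isStar {X : Set ℂ} {x : ℂ} {Θ : Set Real.Angle}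
    (h : ∀ᶠ z in 𝓝[≠] x, z ∈ X ↔ dir x z ∈ Θ) : ∃ L, IsStar X x Θ L := by
  rw [eventually_nhdsWithin_iff, Metric.eventually_nhds_iff] at h
  obtain ⟨ε, hε, h⟩ := h
  refine ⟨Real.log ε, fun s hs => ?_⟩
  rw [h, dir_add_exp]
  · simpa [Complex.norm_exp] using (Real.lt_log_iff_exp_lt hε).1 hs
  · simp [Complex.exp_ne_zero]

theorem exists_eq_add_exp {x z : ℂ} (hz : z ≠ x) : ∃ s, z = x + Complex.exp s ∧
    s.re = Real.log ‖z - x‖ :=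
  ⟨Complex.log (z - x), by rw [Complex.exp_log (sub_ne_zero.2 hz)]; ring, Complex.log_re _⟩

namespace IsStar

variable {X : Set ℂ} {x : ℂ} {Θ : Set Real.Angle} {L : ℝ}

/-- In the logarithmic coordinate `s` the region is a convex half-strip; its image is connected and
misses `X`. -/
theorem component_eq_of_uIcc (h : IsStar X x Θ L) {s s' : ℂ} (hs : s.re < L) (hs' : s'.re < L)
    (hI : ∀ θ ∈ Set.uIcc s.im s'.im, (θ : Real.Angle) ∉ Θ) :
    connectedComponentIn Xᶜ (x + Complex.exp s) = connectedComponentIn Xᶜ (x + Complex.exp s') := by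
  set S : Set ℂ := Set.Iio L ×ℂ Set.uIcc s.im s'.im with hS
  have hconv : Convex ℝ S := ((convex_Iio L).linear_preimage Complex.reLm).inter
    ((convex_uIcc s.im s'.im).linear_preimage Complex.imLm)
  have hcont : Continuous fun u : ℂ => x + Complex.exp u := by fun_prop
  have hpre := hconv.isPreconnected.image _ hcont.continuousOn
  have hmem : ∀ u : ℂ, u ∈ S ↔ u.re < L ∧ u.im ∈ Set.uIcc s.im s'.im := by
    intro u
    rw [hS, Complex.mem_reProdIm, Set.mem_Iio]
  have hsub : (fun u : ℂ => x + Complex.exp u) '' S ⊆ Xᶜ := by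
    rintro _ ⟨u, hu, rfl⟩
    rw [hmem] at hu
    rw [Set.mem_compl_iff, h u hu.1]
    exact hI _ hu.2
  have h1 := hpre.subset_connectedComponentIn
    (Set.mem_image_of_mem _ ((hmem s).2 ⟨hs, Set.left_mem_uIcc⟩)) hsub
  exact connectedComponentIn_eq (h1 (Set.mem_image_of_mem _ ((hmem s').2 ⟨hs', Set.right_mem_uIcc⟩)))

/-- The component of the complement that contains the points near `x` in direction `θ`. -/
noncomputable def sector (X : Set ℂ) (x : ℂ) (L : ℝ) (θ : ℝ) : Set ℂ :=
  connectedComponentIn Xᶜ (x + Complex.exp (((L - 1 : ℝ) : ℂ) + θ * Complex.I))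

theorem component_eq_sector (h : IsStar X x Θ L) {s : ℂ} (hs : s.re < L) {θ : ℝ}
    (hI : ∀ t ∈ Set.uIcc s.im θ, (t : Real.Angle) ∉ Θ) :
    connectedComponentIn Xᶜ (x + Complex.exp s) = sector X x L θ :=
  h.component_eq_of_uIcc hs (by simp) (by simpa using hI)

theorem sector_eq_sector (h : IsStar X x Θ L) {θ θ' : ℝ}
    (hI : ∀ t ∈ Set.uIcc θ θ', (t : Real.Angle) ∉ Θ) : sector X x L θ = sector X x L θ' :=
  h.component_eq_sector (by simp) (by simpa using hI)

theorem sector_mem (h : IsStar X x Θ L) {θ : ℝ} (hθ : (θ : Real.Angle) ∉ Θ) :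
    sector X x L θ ∈ complementComponents X := by
  refine component_mem ?_
  rw [h _ (by simp)]
  simpa using hθ

theorem mem_sector (h : IsStar X x Θ L) {s : ℂ} (hs : s.re < L) {θ : ℝ}
    (hI : ∀ t ∈ Set.uIcc s.im θ, (t : Real.Angle) ∉ Θ) : x + Complex.exp s ∈ sector X x L θ := by
  rw [← h.component_eq_sector hs hI]
  refine mem_connectedComponentIn ?_
  rw [Set.mem_compl_iff, h s hs]
  exact hI _ Set.left_mem_uIcc

theorem mem_closure_sector_left (h : IsStar X x Θ L) {θ θ' : ℝ} (hθ : θ < θ')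
    (hI : ∀ t ∈ Set.Ioc θ θ', (t : Real.Angle) ∉ Θ) {l : ℝ} (hl : l < L) :
    x + Complex.exp (l + θ * Complex.I) ∈ closure (sector X x L θ') := by
  have h1 : Tendsto (fun t : ℝ => x + Complex.exp (l + t * Complex.I)) (𝓝[>] θ)
      (𝓝 (x + Complex.exp (l + θ * Complex.I))) := by
    have : Continuous fun t : ℝ => x + Complex.exp (l + t * Complex.I) := by fun_prop
    exact this.continuousAt.tendsto.mono_left nhdsWithin_le_nhds
  refine mem_closure_of_tendsto h1 ?_
  filter_upwards [Ioc_mem_nhdsGT hθ] with t ht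
  refine h.mem_sector (by simpa using hl) ?_
  intro u hu
  simp only [Complex.add_im, Complex.ofReal_im, Complex.mul_im, Complex.ofReal_re, Complex.I_im,
    mul_one, Complex.I_re, mul_zero, add_zero, zero_add, Set.uIcc_of_le ht.2] at hu
  exact hI u ⟨ht.1.trans_le hu.1, hu.2⟩

theorem mem_closure_sector_right (h : IsStar X x Θ L) {θ θ' : ℝ} (hθ : θ' < θ)
    (hI : ∀ t ∈ Set.Ico θ' θ, (t : Real.Angle) ∉ Θ) {l : ℝ} (hl : l < L) :
    x + Complex.exp (l + θ * Complex.I) ∈ closure (sector X x L θ') := by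
  have h1 : Tendsto (fun t : ℝ => x + Complex.exp (l + t * Complex.I)) (𝓝[<] θ)
      (𝓝 (x + Complex.exp (l + θ * Complex.I))) := by
    have : Continuous fun t : ℝ => x + Complex.exp (l + t * Complex.I) := by fun_prop
    exact this.continuousAt.tendsto.mono_left nhdsWithin_le_nhds
  refine mem_closure_of_tendsto h1 ?_
  filter_upwards [Ico_mem_nhdsLT hθ] with t ht
  refine h.mem_sector (by simpa using hl) ?_
  intro u hu
  simp only [Complex.add_im, Complex.ofReal_im, Complex.mul_im, Complex.ofReal_re, Complex.I_im,
    mul_one, Complex.I_re, mul_zero, add_zero, zero_add, Set.uIcc_of_ge ht.1] at hu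
  exact hI u ⟨hu.1, hu.2.trans_lt ht.2⟩

theorem mem_closure_sector_center (h : IsStar X x Θ L) {θ : ℝ} (hθ : (θ : Real.Angle) ∉ Θ) :
    x ∈ closure (sector X x L θ) := by
  refine mem_closure_of_tendsto ((tendsto_add_exp x θ).mono_right nhdsWithin_le_nhds) ?_
  filter_upwards [eventually_lt_atBot L] with l hl
  refine h.mem_sector (by simpa using hl) ?_
  simpa using hθ

/-- On both sides of a ray of a star there are only the two adjacent sectors. -/
theorem sides_eq_of_ray (h : IsStar X x Θ L) {α δ l : ℝ} (hl : l < L)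
    (hα : (α : Real.Angle) ∈ Θ) (hδ : 0 < δ)
    (hI : ∀ t : ℝ, 0 < |t - α| → |t - α| ≤ δ → (t : Real.Angle) ∉ Θ) :
    sides X (x + Complex.exp (l + α * Complex.I)) =
      {sector X x L (α + δ), sector X x L (α - δ)} := by
  have hp : ∀ t ∈ Set.Ioc α (α + δ), (t : Real.Angle) ∉ Θ := fun t ht =>
    hI t (abs_pos.2 (by linarith [ht.1])) (abs_le.2 ⟨by linarith [ht.1], by linarith [ht.2]⟩)
  have hm : ∀ t ∈ Set.Ico (α - δ) α, (t : Real.Angle) ∉ Θ := fun t ht =>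
    hI t (abs_pos.2 (by linarith [ht.2])) (abs_le.2 ⟨by linarith [ht.1], by linarith [ht.2]⟩)
  ext f
  simp only [Set.mem_insert_iff, Set.mem_singleton_iff]
  constructor
  · rintro ⟨hf, hyf⟩
    set s0 : ℂ := l + α * Complex.I with hs0
    have hN : {s : ℂ | s.re < L ∧ |s.im - α| < δ} ∈ 𝓝 s0 := by
      refine IsOpen.mem_nhds ?_ ?_
      · exact (isOpen_lt Complex.continuous_re continuous_const).inter
          (isOpen_lt (continuous_abs.comp (Complex.continuous_im.sub continuous_const))
            continuous_const)
      · simp [hs0, hl, hδ]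
    -- The exponential is locally open, so points of `f` near the ray have coordinates near `s0`.
    have hd : HasStrictDerivAt (fun s : ℂ => x + Complex.exp s) (Complex.exp s0) s0 :=
      (Complex.hasStrictDerivAt_exp s0).const_add x
    have hmap := hd.map_nhds_eq (Complex.exp_ne_zero _)
    obtain ⟨z, ⟨s, hs, rfl⟩, hzf⟩ := mem_closure_iff_nhds.1 hyf _
      (hmap ▸ image_mem_map hN)
    have hsα : s.im ≠ α := by
      intro hsα
      apply notMem_of_mem_component hf hzf
      rw [h s hs.1, hsα]
      exact hα
    rw [component_eq hf hzf]
    have hs2 := abs_lt.1 hs.2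
    rcases lt_or_gt_of_ne hsα with hlt | hlt
    · right
      refine h.component_eq_sector hs.1 fun t ht => ?_
      rw [Set.uIcc_of_ge (by linarith)] at ht
      exact hm t ⟨ht.1, ht.2.trans_lt hlt⟩
    · left
      refine h.component_eq_sector hs.1 fun t ht => ?_
      rw [Set.uIcc_of_le (by linarith)] at ht
      exact hp t ⟨hlt.trans_le ht.1, ht.2⟩
  · rintro (rfl | rfl)
    · exact ⟨h.sector_mem (hp _ ⟨by linarith, le_refl _⟩),
        h.mem_closure_sector_left (by linarith) hp hl⟩
    · exact ⟨h.sector_mem (hm _ ⟨le_refl _, by linarith⟩),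
        h.mem_closure_sector_right (by linarith) hm hl⟩

end IsStar

/-- Near a point where `X` looks like two rays, all points of `X` have the same two sides. -/
theorem exists_two_sides {X : Set ℂ} {x : ℂ} {a b : Real.Angle} (hab : a ≠ b)
    (hxX : x ∈ X) (h : ∀ᶠ z in 𝓝[≠] x, z ∈ X ↔ dir x z = a ∨ dir x z = b) :
    ∃ f g, ∀ᶠ y in 𝓝 x, (y ∈ X → sides X y = {f, g}) ∧
      (y ∉ X → connectedComponentIn Xᶜ y = f ∨ connectedComponentIn Xᶜ y = g) := by
  obtain ⟨L, hL⟩ := exists_isStar (Θ := {a, b}) h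
  obtain ⟨α, rfl⟩ : ∃ α : ℝ, (α : Real.Angle) = a := ⟨a.toReal, a.coe_toReal⟩
  -- With this lift of `b` the two sectors are the angle intervals (α, β) and (β, α + 2π).
  obtain ⟨β, rfl, hβ⟩ : ∃ β : ℝ, (β : Real.Angle) = b ∧ β ∈ Set.Ico α (α + 2 * Real.pi) :=
    ⟨toIcoMod Real.two_pi_pos α b.toReal, by rw [Real.Angle.coe_toIcoMod, b.coe_toReal],
      toIcoMod_mem_Ico _ _ _⟩
  have hαβ : α < β := lt_of_le_of_ne hβ.1 (by rintro rfl; exact hab rfl)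
  have hβα : β < α + 2 * Real.pi := hβ.2
  have hα2 : ((α + 2 * Real.pi : ℝ) : Real.Angle) = α := by simp
  have hmod : ∀ (c t : ℝ), (t : Real.Angle) = c → c - 2 * Real.pi < t → t < c + 2 * Real.pi →
      t = c := by
    intro c t ht h1 h2
    obtain ⟨k, hk⟩ := Real.Angle.angle_eq_iff_two_pi_dvd_sub.1 ht
    have hk1 : (k : ℝ) < 1 := by nlinarith [Real.two_pi_pos]
    have hk2 : (-1 : ℝ) < k := by nlinarith [Real.two_pi_pos]
    have hk0 : k = 0 := by
      have h3 : k < 1 := by exact_mod_cast hk1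
      have h4 : -1 < k := by exact_mod_cast hk2
      omega
    rw [hk0] at hk
    simp only [Int.cast_zero, mul_zero, sub_eq_zero] at hk
    exact hk
  have hI1 : ∀ t ∈ Set.Ioo α β, (t : Real.Angle) ∉ ({(α : Real.Angle), (β : Real.Angle)} : Set _) := by
    rintro t ⟨h1, h2⟩ (h3 | h3)
    · exact h1.ne' (hmod _ _ h3 (by linarith) (by linarith))
    · exact h2.ne (hmod _ _ h3 (by linarith) (by linarith))
  have hI2 : ∀ t ∈ Set.Ioo β (α + 2 * Real.pi),
      (t : Real.Angle) ∉ ({(α : Real.Angle), (β : Real.Angle)} : Set _) := by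
    rintro t ⟨h1, h2⟩ (h3 | h3)
    · exact h2.ne (hmod _ _ (h3.trans hα2.symm) (by linarith) (by linarith))
    · exact h1.ne' (hmod _ _ h3 (by linarith) (by linarith))
  obtain ⟨m1, hm1⟩ := exists_between hαβ
  obtain ⟨m2, hm2⟩ := exists_between hβα
  refine ⟨IsStar.sector X x L m1, IsStar.sector X x L m2, ?_⟩
  have hcomp : ∀ s : ℂ, s.re < L → x + Complex.exp s ∉ X →
      connectedComponentIn Xᶜ (x + Complex.exp s) = IsStar.sector X x L m1 ∨
      connectedComponentIn Xᶜ (x + Complex.exp s) = IsStar.sector X x L m2 := by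
    intro s hs hsX
    set n := toIcoDiv Real.two_pi_pos α s.im
    have hmem : s.im - n • (2 * Real.pi) ∈ Set.Ico α (α + 2 * Real.pi) :=
      toIcoMod_mem_Ico Real.two_pi_pos α s.im
    -- The same point, with its argument moved into [α, α + 2π).
    set s' : ℂ := s - n * (2 * Real.pi * Complex.I) with hs'
    have he : Complex.exp s' = Complex.exp s := Complex.exp_periodic.sub_int_mul_eq n
    have hre : s'.re = s.re := by simp [hs']
    have him : s'.im = s.im - n • (2 * Real.pi) := by simp [hs']
    rw [← him] at hmem
    rw [← he] at hsX ⊢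
    rw [← hre] at hs
    rw [hL s' hs, Set.mem_insert_iff, Set.mem_singleton_iff, not_or] at hsX
    have h1 : s'.im ≠ α := fun h => hsX.1 (by rw [h])
    have h2 : s'.im ≠ β := fun h => hsX.2 (by rw [h])
    have h3 : α < s'.im := lt_of_le_of_ne hmem.1 h1.symm
    rcases lt_or_gt_of_ne h2 with h4 | h4
    · left
      refine hL.component_eq_sector hs fun t ht => hI1 t ?_
      exact (Set.ordConnected_Ioo.uIcc_subset ⟨h3, h4⟩ hm1) ht
    · right
      refine hL.component_eq_sector hs fun t ht => hI2 t ?_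
      exact (Set.ordConnected_Ioo.uIcc_subset ⟨h4, hmem.2⟩ hm2) ht
  have hball : Metric.ball x (Real.exp L) ∈ 𝓝 x := Metric.ball_mem_nhds _ (Real.exp_pos L)
  have hpolar : ∀ z ∈ Metric.ball x (Real.exp L), z ≠ x → ∃ s : ℂ, s.re < L ∧
      z = x + Complex.exp s := by
    intro z hz hzx
    obtain ⟨s, hs, hre⟩ := exists_eq_add_exp hzx
    refine ⟨s, ?_, hs⟩
    rw [hre, Real.log_lt_iff_lt_exp (by simpa [sub_eq_zero] using hzx)]
    simpa [dist_eq_norm] using hz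
  have hcomp' : ∀ z ∈ Metric.ball x (Real.exp L), z ∉ X →
      connectedComponentIn Xᶜ z = IsStar.sector X x L m1 ∨
      connectedComponentIn Xᶜ z = IsStar.sector X x L m2 := by
    intro z hz hzX
    obtain ⟨s, hs, rfl⟩ := hpolar z hz (by rintro rfl; exact hzX hxX)
    exact hcomp s hs hzX
  filter_upwards [hball] with y hy
  refine ⟨fun hyX => ?_, hcomp' y hy⟩
  have hf1 := hL.sector_mem (hI1 m1 hm1)
  have hf2 := hL.sector_mem (hI2 m2 hm2)
  apply Set.Subset.antisymm
  · rintro f ⟨hf, hyf⟩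
    obtain ⟨z, hz, hzf⟩ := mem_closure_iff.1 hyf _ Metric.isOpen_ball hy
    rw [component_eq hf hzf]
    exact hcomp' z hz (notMem_of_mem_component hf hzf)
  · have key : y ∈ closure (IsStar.sector X x L m1) ∧ y ∈ closure (IsStar.sector X x L m2) := by
      by_cases hyx : y = x
      · subst hyx
        exact ⟨hL.mem_closure_sector_center (hI1 m1 hm1),
          hL.mem_closure_sector_center (hI2 m2 hm2)⟩
      · obtain ⟨s, hs, rfl⟩ := hpolar y hy hyx
        rw [hL s hs] at hyX
        have hangle : ∀ c : ℝ, (s.im : Real.Angle) = c →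
            Complex.exp s = Complex.exp (s.re + c * Complex.I) := by
          intro c hc
          obtain ⟨k, hk⟩ := Real.Angle.angle_eq_iff_two_pi_dvd_sub.1 hc
          rw [Complex.exp_eq_exp_iff_exists_int]
          refine ⟨k, ?_⟩
          apply Complex.ext
          · simp
          · simp
            linarith
        rcases hyX with hyX | hyX
        · constructor
          · rw [hangle α hyX]
            exact hL.mem_closure_sector_left hm1.1
              (fun t ht => hI1 t ⟨ht.1, ht.2.trans_lt hm1.2⟩) hs
          -- The ray in direction α bounds the second sector from above as the angle α + 2π.
          · rw [hangle (α + 2 * Real.pi) (by rw [hα2]; exact hyX)]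
            exact hL.mem_closure_sector_right hm2.2
              (fun t ht => hI2 t ⟨hm2.1.trans_le ht.1, ht.2⟩) hs
        · rw [hangle β hyX]
          exact ⟨hL.mem_closure_sector_right hm1.2
            (fun t ht => hI1 t ⟨hm1.1.trans_le ht.1, ht.2⟩) hs,
            hL.mem_closure_sector_left hm2.1
              (fun t ht => hI2 t ⟨ht.1, ht.2.trans_lt hm2.2⟩) hs⟩
    rintro f (rfl | rfl)
    · exact ⟨hf1, key.1⟩
    · exact ⟨hf2, key.2⟩

/-! ### Jumps of a periodic function. -/

open Classical in
/-- The jumps of a `2π`-periodic piecewise constant function over one period sum up to zero. -/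
theorem sum_jumps_eq_zero (g : ℝ → ZMod 2) (hg : Function.Periodic g (2 * Real.pi))
    (Θ : Finset Real.Angle) (J : Real.Angle → ZMod 2) (hJ0 : ∀ a, a ∉ Θ → J a = 0)
    (hJ : ∀ x : ℝ, ∃ c, (∀ᶠ y in 𝓝[<] x, g y = c) ∧ ∀ᶠ y in 𝓝[>] x, g y = c + J x) :
    ∑ a ∈ Θ, J a = 0 := by
  -- A staircase that rises by one at every real lift of `a` and is constant in between.
  set N : Real.Angle → ℝ → ℤ := fun a x => ⌊(x - a.toReal) / (2 * Real.pi)⌋ with hN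
  have hNper : ∀ a x, N a (x + 2 * Real.pi) = N a x + 1 := by
    intro a x
    have : (x + 2 * Real.pi - a.toReal) / (2 * Real.pi) = (x - a.toReal) / (2 * Real.pi) + 1 := by
      field_simp
      ring
    simp only [hN, this, Int.floor_add_one]
  have hNR : ∀ a x, ∀ᶠ y in 𝓝[>] x, N a y = N a x := by
    intro a x
    have h1 : Continuous fun y : ℝ => (y - a.toReal) / (2 * Real.pi) := by fun_prop
    have h2 : ∀ᶠ y in 𝓝[>] x, (y - a.toReal) / (2 * Real.pi) < N a x + 1 :=
      nhdsWithin_le_nhds (h1.continuousAt.eventually_lt continuousAt_const (Int.lt_floor_add_one _))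
    filter_upwards [h2, self_mem_nhdsWithin] with y h3 h4
    have h5 : x < y := h4
    rw [hN, Int.floor_eq_iff]
    refine ⟨(Int.floor_le ((x - a.toReal) / (2 * Real.pi))).trans ?_, h3⟩
    gcongr
  have hNL : ∀ a x, ∀ᶠ y in 𝓝[<] x, N a y = N a x - if a = (x : Real.Angle) then 1 else 0 := by
    intro a x
    have h1 : Continuous fun y : ℝ => (y - a.toReal) / (2 * Real.pi) := by fun_prop
    split_ifs with hax
    · have hx : ∃ k : ℤ, (x - a.toReal) / (2 * Real.pi) = k := by
        rw [← a.coe_toReal] at hax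
        obtain ⟨k, hk⟩ := Real.Angle.angle_eq_iff_two_pi_dvd_sub.1 hax.symm
        exact ⟨k, by rw [hk]; field_simp⟩
      obtain ⟨k, hk⟩ := hx
      have hNk : N a x = k := by simp only [hN, hk, Int.floor_intCast]
      have h2 : ∀ᶠ y in 𝓝[<] x, (k : ℝ) - 1 < (y - a.toReal) / (2 * Real.pi) :=
        nhdsWithin_le_nhds (continuousAt_const.eventually_lt h1.continuousAt (by rw [hk]; linarith))
      filter_upwards [h2, self_mem_nhdsWithin] with y h3 h4
      have h5 : y < x := h4
      rw [hNk, hN, Int.floor_eq_iff]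
      push_cast
      refine ⟨h3.le, ?_⟩
      rw [sub_add_cancel, ← hk]
      gcongr
    · have h3 : (N a x : ℝ) < (x - a.toReal) / (2 * Real.pi) := by
        refine lt_of_le_of_ne (Int.floor_le _) fun h => hax ?_
        rw [← a.coe_toReal, eq_comm]
        refine Real.Angle.angle_eq_iff_two_pi_dvd_sub.2 ⟨N a x, ?_⟩
        rw [h]
        field_simp
      have h2 : ∀ᶠ y in 𝓝[<] x, (N a x : ℝ) < (y - a.toReal) / (2 * Real.pi) :=
        nhdsWithin_le_nhds (continuousAt_const.eventually_lt h1.continuousAt h3)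
      filter_upwards [h2, self_mem_nhdsWithin] with y h3 h4
      have h5 : y < x := h4
      rw [sub_zero, hN, Int.floor_eq_iff]
      refine ⟨h3.le, lt_of_le_of_lt ?_ (Int.lt_floor_add_one ((x - a.toReal) / (2 * Real.pi)))⟩
      gcongr
  -- Subtracting the staircases removes all jumps, at the price that `h` changes over one period by
  -- the sum of the jumps. Absence of jumps then forces this sum to vanish.
  set h : ℝ → ZMod 2 := fun x => g x - ∑ a ∈ Θ, J a * (N a x : ZMod 2) with hh
  have hloc : ∀ x, ∃ c, ∀ᶠ y in 𝓝[≠] x, h y = c := by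
    intro x
    obtain ⟨c, hl, hr⟩ := hJ x
    have hR := (Filter.eventually_all_finset Θ).2 fun a _ => hNR a x
    have hL := (Filter.eventually_all_finset Θ).2 fun a _ => hNL a x
    refine ⟨c + J x - ∑ a ∈ Θ, J a * (N a x : ZMod 2), ?_⟩
    rw [← nhdsLT_sup_nhdsGT, eventually_sup]
    constructor
    · filter_upwards [hl, hL] with y h1 h2
      have h3 : ∑ a ∈ Θ, J a * (N a y : ZMod 2) =
          ∑ a ∈ Θ, (J a * (N a x : ZMod 2) - if a = (x : Real.Angle) then J a else 0) := by
        refine Finset.sum_congr rfl fun a ha => ?_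
        rw [h2 a ha]
        split_ifs <;> push_cast <;> ring
      rw [hh]
      simp only [h1, h3, Finset.sum_sub_distrib, Finset.sum_ite_eq']
      split_ifs with hx
      · ring
      · rw [hJ0 _ hx]; ring
    · filter_upwards [hr, hR] with y h1 h2
      rw [hh]
      simp only [h1]
      congr 1
      exact Finset.sum_congr rfl fun a ha => by rw [h2 a ha]
  choose c hc using hloc
  have hcc : ∀ x, ∀ᶠ y in 𝓝 x, c y = c x := by
    intro x
    have h1 := eventually_eventually_nhdsWithin.2 (hc x)
    rw [eventually_nhdsWithin_iff] at h1
    filter_upwards [h1] with y hy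
    by_cases hyx : y = x
    · rw [hyx]
    · have h2 := hy hyx
      have h3 : ∀ᶠ z in 𝓝[≠] y, h z = c x := by
        rw [nhdsWithin_eq_nhds.2 (isOpen_compl_singleton.mem_nhds hyx)] at h2
        exact h2.filter_mono nhdsWithin_le_nhds
      obtain ⟨z, hz1, hz2⟩ := ((hc y).and h3).exists
      rw [← hz1, hz2]
  have hconst : ∀ x y, c x = c y := by
    intro x y
    have : Continuous c := continuous_iff_continuousAt.2 fun x =>
      tendsto_nhds_of_eventually_eq (hcc x)
    exact PreconnectedSpace.constant inferInstance this
  have hc2 : ∀ᶠ y in 𝓝[≠] (0 : ℝ), h (y + 2 * Real.pi) = c (2 * Real.pi) := by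
    have ht : Tendsto (fun y : ℝ => y + 2 * Real.pi) (𝓝[≠] 0) (𝓝[≠] (2 * Real.pi)) := by
      rw [tendsto_nhdsWithin_iff]
      constructor
      · have : Continuous fun y : ℝ => y + 2 * Real.pi := by fun_prop
        simpa using (this.tendsto 0).mono_left nhdsWithin_le_nhds
      · filter_upwards [self_mem_nhdsWithin] with y hy
        simpa using hy
    exact ht.eventually (hc _)
  obtain ⟨y, h1, h2⟩ := ((hc 0).and hc2).exists
  have h3 : h (y + 2 * Real.pi) = h y - ∑ a ∈ Θ, J a := by
    simp only [hh, hg y, hNper]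
    push_cast
    simp only [mul_add, mul_one, Finset.sum_add_distrib]
    ring
  rw [h3, h1, hconst (2 * Real.pi) 0] at h2
  simpa using h2

/-! ### Sides of edges, connectedness of the dual graph, and evenness of face boundaries. -/

namespace PlaneDrawing

variable {V : Type*} {G : SimpleGraph V} (D : PlaneDrawing G)

/-- The arc of an edge without its ends. -/
def inner (e : Sym2 V) : Set ℂ := D.arc e \ Set.range D.pos

/-- The faces on the two sides of an edge. -/
def edgeSides (e : Sym2 V) : Set (Set ℂ) :=
  {f | f ∈ D.faces ∧ ∃ y ∈ D.inner e, y ∈ closure f}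

variable {D}

theorem exists_isPolygonalArc {e : Sym2 V} (he : e ∈ G.edgeSet) {v : V} (hv : v ∈ e) :
    ∃ w, e = s(v, w) ∧ G.Adj v w ∧ IsPolygonalArc (D.pos v) (D.pos w) (D.arc e) := by
  obtain ⟨w, rfl⟩ := hv
  exact ⟨w, rfl, he, D.isPolygonalArc v w he⟩

theorem isClosed_arc {e : Sym2 V} (he : e ∈ G.edgeSet) : IsClosed (D.arc e) := by
  obtain ⟨w, -, -, h⟩ := exists_isPolygonalArc (D := D) he (Sym2.out_fst_mem e)
  exact h.isClosed

theorem arc_subset_carrier {e : Sym2 V} (he : e ∈ G.edgeSet) : D.arc e ⊆ D.carrier :=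
  fun _ hz => Or.inr (Set.mem_biUnion he hz)

theorem inner_eq {v w : V} (h : G.Adj v w) :
    D.inner s(v, w) = D.arc s(v, w) \ {D.pos v, D.pos w} := by
  ext z
  simp only [inner, Set.mem_sdiff, Set.mem_insert_iff, Set.mem_singleton_iff, not_or]
  refine and_congr_right fun hz => ⟨fun h => ?_, ?_⟩
  · exact ⟨fun h' => h ⟨v, h'.symm⟩, fun h' => h ⟨w, h'.symm⟩⟩
  · rintro ⟨h1, h2⟩ ⟨u, rfl⟩
    have := D.mem_of_pos_mem_arc _ h u hz
    rw [Sym2.mem_iff] at this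
    rcases this with rfl | rfl
    · exact h1 rfl
    · exact h2 rfl

theorem isPreconnected_inner {e : Sym2 V} (he : e ∈ G.edgeSet) : IsPreconnected (D.inner e) := by
  induction e with | _ v w =>
  rw [inner_eq he]
  exact (D.isPolygonalArc v w he).isPreconnected_diff

theorem notMem_arc_of_mem_inner {e e' : Sym2 V} (he : e ∈ G.edgeSet) (he' : e' ∈ G.edgeSet)
    (hne : e' ≠ e) {y : ℂ} (hy : y ∈ D.inner e) : y ∉ D.arc e' := by
  intro hy'
  obtain ⟨u, -, rfl⟩ := D.arc_inter_arc e he e' he' hne.symm ⟨hy.1, hy'⟩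
  exact hy.2 ⟨u, rfl⟩

variable [Finite V]

theorem isClosed_carrier : IsClosed D.carrier :=
  (Set.finite_range D.pos).isClosed.union
    ((Set.toFinite G.edgeSet).isClosed_biUnion fun _ he => isClosed_arc he)

theorem eventually_mem_carrier_iff {e : Sym2 V} (he : e ∈ G.edgeSet) {y : ℂ}
    (hy : y ∈ D.inner e) : ∀ᶠ z in 𝓝 y, z ∈ D.carrier ↔ z ∈ D.arc e := by
  have h1 : ∀ᶠ z in 𝓝 y, z ∉ Set.range D.pos :=
    (Set.finite_range D.pos).isClosed.isOpen_compl.mem_nhds hy.2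
  have h2 : ∀ᶠ z in 𝓝 y, ∀ e' : Sym2 V, e' ∈ G.edgeSet → e' ≠ e → z ∉ D.arc e' := by
    rw [eventually_all]
    intro e'
    by_cases he' : e' ∈ G.edgeSet
    · by_cases hne : e' = e
      · simp [hne]
      · filter_upwards [(isClosed_arc he').isOpen_compl.mem_nhds
          (notMem_arc_of_mem_inner he he' hne hy)] with z hz _ _
        exact hz
    · simp [he']
  filter_upwards [h1, h2] with z h1 h2
  constructor
  · rintro (h | h)
    · exact absurd h h1
    · simp only [Set.mem_iUnion] at h
      obtain ⟨e', he', hz⟩ := h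
      by_cases hne : e' = e
      · rwa [← hne]
      · exact absurd hz (h2 e' he' hne)
  · exact fun h => arc_subset_carrier he h

theorem exists_sides_pair {e : Sym2 V} (he : e ∈ G.edgeSet) {y : ℂ} (hy : y ∈ D.inner e) :
    ∃ f g, ∀ᶠ z in 𝓝 y, (z ∈ D.carrier → sides D.carrier z = {f, g}) ∧
      (z ∉ D.carrier → connectedComponentIn D.carrierᶜ z = f ∨
        connectedComponentIn D.carrierᶜ z = g) := by
  have hX := eventually_mem_carrier_iff he hy
  induction e with | _ v w =>
  have hA := D.isPolygonalArc v w he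
  rw [inner_eq he] at hy
  obtain ⟨hyA, hy'⟩ := hy
  simp only [Set.mem_insert_iff, Set.mem_singleton_iff, not_or] at hy'
  obtain ⟨a, b, hab, h1⟩ := hA.exists_dir_pair hyA hy'.1 hy'.2
  refine exists_two_sides hab (arc_subset_carrier he hyA) ?_
  filter_upwards [h1, nhdsWithin_le_nhds hX] with z h1 h2
  rw [h2, h1]

/-- The set of sides is locally constant along the arc without its ends, which is connected. -/
theorem edgeSides_eq {e : Sym2 V} (he : e ∈ G.edgeSet) {y : ℂ} (hy : y ∈ D.inner e) :
    D.edgeSides e = sides D.carrier y := by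
  have key : ∀ {x y}, x ∈ D.inner e → y ∈ D.inner e → sides D.carrier x = sides D.carrier y := by
    intro x y hx hy
    refine (isPreconnected_inner he).induction₂
      (fun x y => sides D.carrier x = sides D.carrier y) ?_ ?_ ?_ hx hy
    · intro x hx
      obtain ⟨f, g, h⟩ := exists_sides_pair he hx
      have h0 := h.self_of_nhds.1 (arc_subset_carrier he hx.1)
      filter_upwards [nhdsWithin_le_nhds h, self_mem_nhdsWithin] with z hz hz'
      rw [h0, hz.1 (arc_subset_carrier he hz'.1)]
    · exact fun x y z _ _ _ h h' => h.trans h'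
    · exact fun x y _ _ h => h.symm
  ext f
  constructor
  · rintro ⟨hf, x, hx, hxf⟩
    rw [key hy hx]
    exact ⟨hf, hxf⟩
  · rintro ⟨hf, hyf⟩
    exact ⟨hf, y, hy, hyf⟩

omit [Finite V] in
theorem inner_nonempty {e : Sym2 V} (he : e ∈ G.edgeSet) : (D.inner e).Nonempty := by
  induction e with | _ v w =>
  have hA := D.isPolygonalArc v w he
  obtain ⟨a, ha⟩ := hA.exists_dir_left
  have h1 : ∀ᶠ z in 𝓝[≠] D.pos v, z ≠ D.pos w :=
    nhdsWithin_le_nhds (isOpen_compl_singleton.mem_nhds hA.ne)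
  obtain ⟨z, h2, h3, h4, h5⟩ := ((frequently_dir_eq (D.pos v) a).and_eventually
    (ha.and (h1.and self_mem_nhdsWithin))).exists
  rw [inner_eq he]
  exact ⟨z, h3.2 h2, by
    simp only [Set.mem_insert_iff, Set.mem_singleton_iff, not_or]
    exact ⟨h5, h4⟩⟩

theorem exists_edgeSides_eq {e : Sym2 V} (he : e ∈ G.edgeSet) :
    ∃ f g, D.edgeSides e = {f, g} := by
  obtain ⟨y, hy⟩ := inner_nonempty (D := D) he
  obtain ⟨f, g, h⟩ := exists_sides_pair he hy
  exact ⟨f, g, by rw [edgeSides_eq he hy, h.self_of_nhds.1 (arc_subset_carrier he hy.1)]⟩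

omit [Finite V] in
theorem edgeSides_subset (e : Sym2 V) : D.edgeSides e ⊆ D.faces := fun _ h => h.1

/-- Crossing edges one gets from every face to every other one. -/
theorem eq_univ_of_closed {S : Set (Set ℂ)} (hS : S ⊆ D.faces) (hne : S.Nonempty)
    (h : ∀ e ∈ G.edgeSet, ∀ f ∈ D.edgeSides e, ∀ g ∈ D.edgeSides e, f ∈ S → g ∈ S) :
    S = D.faces := by
  -- Off the vertices the plane is connected, so it suffices that having a side in `S` is a locally
  -- constant property there; at points of edges this is the hypothesis on `S`.
  have hconn : IsPreconnected (Set.range D.pos)ᶜ :=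
    ((Set.finite_range D.pos).countable.isPathConnected_compl_of_one_lt_rank
      (by rw [Complex.rank_real_complex]; exact Nat.one_lt_ofNat)).isConnected.isPreconnected
  have hX := isClosed_carrier (D := D)
  have key : ∀ {x y}, x ∈ (Set.range D.pos)ᶜ → y ∈ (Set.range D.pos)ᶜ →
      ((sides D.carrier x ∩ S).Nonempty ↔ (sides D.carrier y ∩ S).Nonempty) := by
    intro x y hx hy
    refine hconn.induction₂
      (fun x y => (sides D.carrier x ∩ S).Nonempty ↔ (sides D.carrier y ∩ S).Nonempty)
      ?_ ?_ ?_ hx hy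
    · intro x hx
      by_cases hxX : x ∈ D.carrier
      · have hxe : ∃ e ∈ G.edgeSet, x ∈ D.arc e := by
          rcases hxX with h | h
          · exact absurd h hx
          · simpa using h
        obtain ⟨e, he, hxe⟩ := hxe
        have hxi : x ∈ D.inner e := ⟨hxe, hx⟩
        obtain ⟨f, g, hfg⟩ := exists_sides_pair he hxi
        have h0 := hfg.self_of_nhds.1 hxX
        have hes := edgeSides_eq he hxi
        filter_upwards [nhdsWithin_le_nhds hfg] with z hz
        by_cases hzX : z ∈ D.carrier
        · rw [h0, hz.1 hzX]
        · rw [sides_of_notMem hX hzX, ← hes]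
          have hzm : connectedComponentIn D.carrierᶜ z ∈ D.edgeSides e := by
            rw [hes, h0]
            exact hz.2 hzX
          constructor
          · rintro ⟨k, hk, hkS⟩
            exact ⟨_, rfl, h e he k hk _ hzm hkS⟩
          · rintro ⟨k, rfl, hkS⟩
            exact ⟨_, hzm, hkS⟩
      · have hopen := (hX.isOpen_compl.connectedComponentIn (x := x)).mem_nhds
          (mem_connectedComponentIn hxX)
        filter_upwards [nhdsWithin_le_nhds hopen] with z hz
        rw [sides_of_notMem hX hxX,
          sides_of_notMem hX (connectedComponentIn_subset _ _ hz : z ∈ D.carrierᶜ),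
          connectedComponentIn_eq hz]
    · exact fun x y z _ _ _ h h' => h.trans h'
    · exact fun x y _ _ h => h.symm
  refine hS.antisymm fun g hg => ?_
  obtain ⟨f, hf⟩ := hne
  have hout : ∀ k ∈ D.faces, ∃ z, z ∈ (Set.range D.pos)ᶜ ∧ sides D.carrier z = {k} := by
    rintro _ ⟨z, hz, rfl⟩
    exact ⟨z, fun h => hz (Or.inl h), sides_of_notMem hX hz⟩
  obtain ⟨z, hz, hzf⟩ := hout f (hS hf)
  obtain ⟨w, hw, hwg⟩ := hout g hg
  have := (key hz hw).1 (by rw [hzf]; exact ⟨f, rfl, hf⟩)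
  rw [hwg] at this
  obtain ⟨k, rfl, hk⟩ := this
  exact hk

/-- An edge has at most two sides, and a face that is no side of any edge is the only face. -/
theorem finite_faces : D.faces.Finite := by
  have hfin : (⋃ e ∈ G.edgeSet, D.edgeSides e).Finite := by
    refine (Set.toFinite G.edgeSet).biUnion fun e he => ?_
    obtain ⟨f, g, h⟩ := exists_edgeSides_eq (D := D) he
    rw [h]
    exact Set.toFinite _
  by_cases hsub : D.faces ⊆ ⋃ e ∈ G.edgeSet, D.edgeSides e
  · exact hfin.subset hsub
  · obtain ⟨f, hf, hf'⟩ := Set.not_subset.1 hsub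
    rw [← eq_univ_of_closed (Set.singleton_subset_iff.2 hf) (Set.singleton_nonempty f)]
    · exact Set.finite_singleton f
    · rintro e he k hk g - rfl
      exact absurd (Set.mem_biUnion he hk) hf'

/-- Two edges leaving `v` in the same direction would share points arbitrarily close to `v` other
than `v`. -/
theorem exists_vertex_dirs (v : V) : ∃ a : Sym2 V → Real.Angle,
    (∀ e ∈ G.edgeSet, v ∈ e → ∀ᶠ z in 𝓝[≠] D.pos v, z ∈ D.arc e ↔ dir (D.pos v) z = a e) ∧
    (∀ e ∈ G.edgeSet, ∀ e' ∈ G.edgeSet, v ∈ e → v ∈ e' → a e = a e' → e = e') ∧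
    ∀ᶠ z in 𝓝[≠] D.pos v, z ∈ D.carrier ↔ ∃ e ∈ G.edgeSet, v ∈ e ∧ dir (D.pos v) z = a e := by
  have h1 : ∀ e : Sym2 V, ∃ a, e ∈ G.edgeSet → v ∈ e →
      ∀ᶠ z in 𝓝[≠] D.pos v, z ∈ D.arc e ↔ dir (D.pos v) z = a := by
    intro e
    by_cases he : e ∈ G.edgeSet ∧ v ∈ e
    · obtain ⟨w, -, -, h⟩ := exists_isPolygonalArc (D := D) he.1 he.2
      obtain ⟨a, ha⟩ := h.exists_dir_left
      exact ⟨a, fun _ _ => ha⟩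
    · exact ⟨0, fun h1 h2 => absurd ⟨h1, h2⟩ he⟩
  choose a ha using h1
  have hpos : ∀ᶠ z in 𝓝[≠] D.pos v, z ∉ Set.range D.pos := by
    have : (Set.range D.pos \ {D.pos v}).Finite := (Set.finite_range _).subset Set.sdiff_subset
    filter_upwards [nhdsWithin_le_nhds (this.isClosed.isOpen_compl.mem_nhds
      (fun h => h.2 rfl : D.pos v ∉ Set.range D.pos \ {D.pos v})), self_mem_nhdsWithin] with z h1 h2
    exact fun h => h1 ⟨h, h2⟩
  refine ⟨a, fun e he hv => ha e he hv, ?_, ?_⟩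
  · intro e he e' he' hv hv' haa
    by_contra hne
    obtain ⟨z, h2, h3, h4, h5⟩ := ((frequently_dir_eq (D.pos v) (a e)).and_eventually
      ((ha e he hv).and ((ha e' he' hv').and hpos))).exists
    obtain ⟨u, -, rfl⟩ := D.arc_inter_arc e he e' he' hne ⟨h3.2 h2, h4.2 (h2.trans haa)⟩
    exact h5 ⟨u, rfl⟩
  · have h2 : ∀ᶠ z in 𝓝[≠] D.pos v, ∀ e : Sym2 V, e ∈ G.edgeSet →
        (z ∈ D.arc e ↔ v ∈ e ∧ dir (D.pos v) z = a e) := by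
      rw [eventually_all]
      intro e
      by_cases he : e ∈ G.edgeSet
      · by_cases hv : v ∈ e
        · filter_upwards [ha e he hv] with z hz _
          simp [hz, hv]
        · filter_upwards [eventually_notMem_of_isClosed (isClosed_arc he)
            (fun h => hv (D.mem_of_pos_mem_arc e he v h))] with z hz _
          simp [hz, hv]
      · simp [he]
    filter_upwards [h2, hpos] with z h2 h3
    constructor
    · rintro (h | h)
      · exact absurd h h3
      · simp only [Set.mem_iUnion] at h
        obtain ⟨e, he, hz⟩ := h
        exact ⟨e, he, (h2 e he).1 hz⟩
    · rintro ⟨e, he, h⟩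
      exact arc_subset_carrier he ((h2 e he).2 h)

variable (D) in
/-- The edges that have the face `f` on exactly one side. -/
def boundary (f : Set ℂ) : Set (Sym2 V) :=
  {e | e ∈ G.edgeSet ∧ f ∈ D.edgeSides e ∧ (D.edgeSides e).Nontrivial}

open Classical in
-- On a full turn around the vertex, the indicator of `f` changes exactly at the boundary edges of
-- `f`, and a periodic function with values in `ZMod 2` changes an even number of times.
theorem even_boundary {f : Set ℂ} (v : V) :
    Even {e | e ∈ D.boundary f ∧ v ∈ e}.ncard := by
  have := Fintype.ofFinite V
  obtain ⟨a, ha, hinj, hX⟩ := exists_vertex_dirs (D := D) v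
  set x := D.pos v with hx
  set I : Finset (Sym2 V) := Finset.univ.filter fun e => e ∈ G.edgeSet ∧ v ∈ e with hI
  set Θ : Finset Real.Angle := I.image a with hΘ
  have hmemI : ∀ {e}, e ∈ I ↔ e ∈ G.edgeSet ∧ v ∈ e := by simp [hI]
  have hstar : ∀ᶠ z in 𝓝[≠] x, z ∈ D.carrier ↔ dir x z ∈ (Θ : Set Real.Angle) := by
    filter_upwards [hX] with z hz
    rw [hz, Finset.mem_coe, hΘ, Finset.mem_image]
    constructor
    · rintro ⟨e, he, hv, h⟩
      exact ⟨e, hmemI.2 ⟨he, hv⟩, h.symm⟩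
    · rintro ⟨e, he, h⟩
      exact ⟨e, (hmemI.1 he).1, (hmemI.1 he).2, h.symm⟩
  obtain ⟨L, hL⟩ := exists_isStar hstar
  have hinjI : Set.InjOn a I := fun e he e' he' h =>
    hinj e (hmemI.1 he).1 e' (hmemI.1 he').1 (hmemI.1 he).2 (hmemI.1 he').2 h
  set J : Real.Angle → ZMod 2 := fun θ =>
    if ∃ e ∈ I, a e = θ ∧ e ∈ D.boundary f then 1 else 0 with hJ
  set g : ℝ → ZMod 2 := fun θ => if f = IsStar.sector D.carrier x L θ then 1 else 0 with hg
  have hsum := sum_jumps_eq_zero g ?_ Θ J ?_ ?_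
  · rw [hΘ, Finset.sum_image hinjI] at hsum
    have h1 : ∀ e ∈ I, J (a e) = if e ∈ D.boundary f then 1 else 0 := by
      intro e he
      rw [hJ]
      refine if_congr ⟨?_, fun h => ⟨e, he, rfl, h⟩⟩ rfl rfl
      rintro ⟨e', he', h, h'⟩
      rwa [← hinjI he' he h]
    rw [Finset.sum_congr rfl h1, Finset.sum_boole, ZMod.natCast_eq_zero_iff_even] at hsum
    have h2 : {e | e ∈ D.boundary f ∧ v ∈ e} = (I.filter fun e => e ∈ D.boundary f : Finset _) := by
      ext e
      simp only [Set.mem_ofPred_eq, Finset.coe_filter, hmemI]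
      exact ⟨fun h => ⟨⟨h.1.1, h.2⟩, h.1⟩, fun h => ⟨h.2, h.1.2⟩⟩
    rwa [h2, Set.ncard_coe_finset]
  · intro θ
    have h1 : Complex.exp (((L - 1 : ℝ) : ℂ) + ((θ + 2 * Real.pi : ℝ) : ℂ) * Complex.I) =
        Complex.exp (((L - 1 : ℝ) : ℂ) + θ * Complex.I) := by
      rw [← Complex.exp_periodic (((L - 1 : ℝ) : ℂ) + θ * Complex.I)]
      congr 1
      push_cast
      ring
    have h2 : IsStar.sector D.carrier x L (θ + 2 * Real.pi) = IsStar.sector D.carrier x L θ := by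
      rw [IsStar.sector, h1, IsStar.sector]
    simp only [hg, h2]
  · intro θ hθ
    rw [hJ]
    refine if_neg ?_
    rintro ⟨e, he, rfl, -⟩
    exact hθ (Finset.mem_image_of_mem a he)
  · intro θ
    have hev := eventually_coe_angle_notMem Θ.finite_toSet θ
    rw [eventually_nhdsWithin_iff, Metric.eventually_nhds_iff] at hev
    obtain ⟨ε, hε, hev⟩ := hev
    have hδ : 0 < ε / 2 := by linarith
    have hev' : ∀ t : ℝ, 0 < |t - θ| → |t - θ| ≤ ε / 2 → (t : Real.Angle) ∉ (Θ : Set _) := by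
      intro t h1 h2
      refine hev (by rw [Real.dist_eq]; linarith) ?_
      rw [abs_pos, sub_ne_zero] at h1
      exact h1
    set sp := IsStar.sector D.carrier x L (θ + ε / 2) with hsp
    set sm := IsStar.sector D.carrier x L (θ - ε / 2) with hsm
    refine ⟨if f = sm then 1 else 0, ?_, ?_⟩
    · filter_upwards [Ico_mem_nhdsLT (show θ - ε / 2 < θ by linarith)] with y hy
      rw [hg]
      simp only
      rw [hsm, hL.sector_eq_sector (θ := y) (θ' := θ - ε / 2)]
      intro t ht
      rw [Set.uIcc_of_ge hy.1] at ht
      have : t < θ := ht.2.trans_lt hy.2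
      exact hev' t (abs_pos.2 (by linarith)) (abs_le.2 ⟨by linarith [ht.1], by linarith⟩)
    · filter_upwards [Ioc_mem_nhdsGT (show θ < θ + ε / 2 by linarith)] with y hy
      have h1 : IsStar.sector D.carrier x L y = sp := by
        refine hL.sector_eq_sector (θ := y) (θ' := θ + ε / 2) fun t ht => ?_
        rw [Set.uIcc_of_le hy.2] at ht
        have : θ < t := hy.1.trans_le ht.1
        exact hev' t (abs_pos.2 (by linarith)) (abs_le.2 ⟨by linarith, by linarith [ht.2]⟩)
      rw [hg]
      simp only [h1]
      by_cases hθ : (θ : Real.Angle) ∈ (Θ : Set _)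
      · obtain ⟨e, he, hae⟩ := Finset.mem_image.1 hθ
        obtain ⟨he', hv⟩ := hmemI.1 he
        have hyi : ∃ l < L, x + Complex.exp (l + θ * Complex.I) ∈ D.inner e := by
          obtain ⟨w, rfl, hadj, hA⟩ := exists_isPolygonalArc (D := D) he' hv
          have h2 : ∀ᶠ z in 𝓝[≠] x, z ≠ D.pos w :=
            nhdsWithin_le_nhds (isOpen_compl_singleton.mem_nhds hA.ne)
          have h3 := (tendsto_add_exp x θ).eventually
            ((ha _ he' hv).and (h2.and self_mem_nhdsWithin))
          obtain ⟨l, ⟨h4, h5, h6⟩, hl⟩ := (h3.and (eventually_lt_atBot L)).exists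
          refine ⟨l, hl, ?_⟩
          rw [inner_eq hadj]
          refine ⟨h4.2 ?_, ?_⟩
          · rw [dir_add_exp, hae]
            simp
          · simp only [Set.mem_insert_iff, Set.mem_singleton_iff, not_or]
            exact ⟨h6, h5⟩
        obtain ⟨l, hl, hyi⟩ := hyi
        have hes := edgeSides_eq he' hyi
        rw [hL.sides_eq_of_ray hl hθ hδ hev', ← hsp, ← hsm] at hes
        have hJθ : J θ = if f ∈ D.edgeSides e ∧ (D.edgeSides e).Nontrivial then 1 else 0 := by
          rw [hJ]
          refine if_congr ⟨?_, fun h => ⟨e, he, hae, he', h⟩⟩ rfl rfl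
          rintro ⟨e', he'', h, h'⟩
          rw [← hinjI he'' he (h.trans hae.symm)]
          exact h'.2
        rw [hJθ, hes]
        by_cases hpm : sp = sm
        -- The same face on both sides: the edge is not in the boundary and nothing changes.
        · rw [hpm, if_neg (fun h => by simp at h : ¬(f ∈ ({sm, sm} : Set (Set ℂ)) ∧
            ({sm, sm} : Set (Set ℂ)).Nontrivial)), add_zero]
        · have hnt : ({sp, sm} : Set (Set ℂ)).Nontrivial := Set.nontrivial_pair hpm
          simp only [Set.mem_insert_iff, Set.mem_singleton_iff, hnt, and_true]
          by_cases h1 : f = sp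
          · have h2 : f ≠ sm := fun h => hpm (h1.symm.trans h)
            simp [h1, hpm]
          · by_cases h2 : f = sm
            · simp only [h2, if_true, or_true, Ne.symm hpm, if_false]
              -- The indicator drops from one to zero, which is 0 = 1 + 1 modulo 2.
              decide
            · simp [h1, h2]
      · have h2 : sp = sm := by
          refine hL.sector_eq_sector fun t ht => ?_
          by_cases htθ : t = θ
          · rwa [htθ]
          · rw [Set.uIcc_of_ge (by linarith)] at ht
            exact hev' t (abs_pos.2 (sub_ne_zero.2 htθ))
              (abs_le.2 ⟨by linarith [ht.1], by linarith [ht.2]⟩)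
        have h3 : J θ = 0 := by
          rw [hJ]
          refine if_neg ?_
          rintro ⟨e, he, h, -⟩
          exact hθ (h ▸ Finset.mem_image_of_mem a he)
        rw [h2, h3, add_zero]

end PlaneDrawing

/-! ### View angles of arcs and Euler's inequality. -/

/-- A quotient on the closed negative axis would put `z` between `p` and `q`; hence the view angle
is continuous off the segment. -/
theorem div_mem_slitPlane_of_notMem_segment {p q z : ℂ} (hz : z ∉ segment ℝ p q) :
    (q - z) / (p - z) ∈ Complex.slitPlane := by
  have hp : p - z ≠ 0 := fun h => hz (by
    rw [← sub_eq_zero.1 h]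
    exact left_mem_segment _ _ _)
  rw [Complex.mem_slitPlane_iff_not_le_zero]
  intro hle
  rw [Complex.le_def] at hle
  simp only [Complex.zero_re, Complex.zero_im] at hle
  apply hz
  rw [mem_segment_iff_sameRay]
  have h1 : (q - z) / (p - z) = (((q - z) / (p - z)).re : ℂ) := by
    apply Complex.ext
    · simp
    · rw [hle.2]; simp
  rw [div_eq_iff hp] at h1
  have h2 : q - z = (-((q - z) / (p - z)).re) • (z - p) := by
    rw [Complex.real_smul, Complex.ofReal_neg]
    linear_combination h1
  rw [h2]
  exact SameRay.nonneg_smul_right (SameRay.refl _) (by linarith [hle.1])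

theorem continuousAt_arg_div_self {p z₀ : ℂ} (hp : p ≠ z₀) :
    ContinuousAt (fun z => ((p - z) / (p - z₀)).arg) z₀ := by
  have h1 : ContinuousAt (fun z => (p - z) / (p - z₀)) z₀ := by fun_prop
  refine ContinuousAt.comp (g := Complex.arg) (Complex.continuousAt_arg ?_) h1
  rw [div_self (sub_ne_zero.2 hp)]
  simp

/-- The angle under which a segment is seen varies like the directions to its ends. -/
theorem eventually_arg_sub_eq {p q z₀ : ℂ} (hz₀ : z₀ ∉ segment ℝ p q) :
    ∀ᶠ z in 𝓝 z₀, ((q - z) / (p - z)).arg - ((q - z₀) / (p - z₀)).arg =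
      ((q - z) / (q - z₀)).arg - ((p - z) / (p - z₀)).arg := by
  have hp : p ≠ z₀ := by
    rintro rfl
    exact hz₀ (left_mem_segment _ _ _)
  have hq : q ≠ z₀ := by
    rintro rfl
    exact hz₀ (right_mem_segment _ _ _)
  have hp' := sub_ne_zero.2 hp
  have hq' := sub_ne_zero.2 hq
  set Δ : ℂ → ℝ := fun z => ((q - z) / (p - z)).arg - ((q - z₀) / (p - z₀)).arg -
    (((q - z) / (q - z₀)).arg - ((p - z) / (p - z₀)).arg) with hΔ
  have hcont : ContinuousAt Δ z₀ := by
    have h1 : ContinuousAt (fun z => ((q - z) / (p - z)).arg) z₀ := by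
      have h2 : ContinuousAt (fun z => (q - z) / (p - z)) z₀ := by
        refine ContinuousAt.div ?_ ?_ hp' <;> fun_prop
      exact ContinuousAt.comp (g := Complex.arg)
        (Complex.continuousAt_arg (div_mem_slitPlane_of_notMem_segment hz₀)) h2
    exact (h1.sub continuousAt_const).sub
      ((continuousAt_arg_div_self hq).sub (continuousAt_arg_div_self hp))
  have h0 : Δ z₀ = 0 := by simp [hΔ, div_self hp', div_self hq']
  have h1 : ∀ᶠ z in 𝓝 z₀, |Δ z| < 2 * Real.pi := by
    refine hcont.abs.eventually_lt continuousAt_const ?_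
    rw [h0]
    simp [Real.pi_pos]
  have h2 : ∀ᶠ z in 𝓝 z₀, z ≠ p := isOpen_compl_singleton.mem_nhds hp.symm
  have h3 : ∀ᶠ z in 𝓝 z₀, z ≠ q := isOpen_compl_singleton.mem_nhds hq.symm
  filter_upwards [h1, h2, h3] with z h1 h2 h3
  have hpz : p - z ≠ 0 := sub_ne_zero.2 h2.symm
  have hqz : q - z ≠ 0 := sub_ne_zero.2 h3.symm
  -- `Δ` is a multiple of 2π because all arguments cancel as angles, and it is smaller than 2π in
  -- absolute value near `z₀`.
  have h4 : (Δ z : Real.Angle) = ((0 : ℝ) : Real.Angle) := by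
    simp only [hΔ, Real.Angle.coe_sub, Complex.arg_div_coe_angle hqz hpz,
      Complex.arg_div_coe_angle hq' hp', Complex.arg_div_coe_angle hqz hq',
      Complex.arg_div_coe_angle hpz hp', Real.Angle.coe_zero]
    abel
  obtain ⟨k, hk⟩ := Real.Angle.angle_eq_iff_two_pi_dvd_sub.1 h4
  rw [sub_zero] at hk
  rw [hk, abs_mul, abs_of_pos Real.two_pi_pos] at h1
  have h5 : |(k : ℝ)| < 1 := by
    by_contra h
    nlinarith [Real.two_pi_pos]
  have h6 : k = 0 := by
    rw [← Int.abs_lt_one_iff]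
    exact_mod_cast h5
  rw [h6] at hk
  simp only [Int.cast_zero, mul_zero] at hk
  exact sub_eq_zero.1 hk

theorem arg_div_midpoint {p q : ℂ} (hpq : p ≠ q) (t : ℝ) :
    (q - ((p + q) / 2 + t * (Complex.I * (q - p)))) / (p - ((p + q) / 2 + t * (Complex.I * (q - p))))
      = ⟨(t ^ 2 - 1 / 4) / (t ^ 2 + 1 / 4), t / (t ^ 2 + 1 / 4)⟩ := by
  have hd : q - p ≠ 0 := sub_ne_zero.2 hpq.symm
  have h1 : q - ((p + q) / 2 + t * (Complex.I * (q - p))) = (q - p) * ⟨1 / 2, -t⟩ := by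
    have : (⟨1 / 2, -t⟩ : ℂ) = 1 / 2 - t * Complex.I := by
      apply Complex.ext <;> simp
    rw [this]; ring
  have h2 : p - ((p + q) / 2 + t * (Complex.I * (q - p))) = (q - p) * ⟨-(1 / 2), -t⟩ := by
    have : (⟨-(1 / 2), -t⟩ : ℂ) = -(1 / 2) - t * Complex.I := by
      apply Complex.ext <;> simp
    rw [this]; ring
  have h3 : (⟨-(1 / 2), -t⟩ : ℂ) ≠ 0 := by
    intro h
    have := congrArg Complex.re h
    norm_num at this
  rw [h1, h2, mul_div_mul_left _ _ hd, div_eq_iff h3]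
  have h4 : t ^ 2 + 1 / 4 ≠ 0 := by positivity
  apply Complex.ext
  · simp only [Complex.mul_re]
    field_simp
    ring
  · simp only [Complex.mul_im]
    field_simp
    ring

/-- Along the perpendicular bisector the quotient passes through -1 from the lower to the upper
half-plane, so the argument tends to π from one side and to -π from the other. -/
theorem tendsto_arg_jump {p q : ℂ} (hpq : p ≠ q) :
    Tendsto (fun t : ℝ =>
      ((q - ((p + q) / 2 + t * (Complex.I * (q - p)))) /
        (p - ((p + q) / 2 + t * (Complex.I * (q - p))))).arg -
      ((q - ((p + q) / 2 + (-t : ℝ) * (Complex.I * (q - p)))) /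
        (p - ((p + q) / 2 + (-t : ℝ) * (Complex.I * (q - p))))).arg) (𝓝[>] 0) (𝓝 (2 * Real.pi)) := by
  simp only [arg_div_midpoint hpq]
  have hre : ((-1 : ℂ)).re < 0 := by simp
  have him : ((-1 : ℂ)).im = 0 := by simp
  set ρ : ℝ → ℂ := fun t => ⟨(t ^ 2 - 1 / 4) / (t ^ 2 + 1 / 4), t / (t ^ 2 + 1 / 4)⟩ with hρ
  have hcont : Continuous ρ := by
    have h4 : ∀ t : ℝ, t ^ 2 + 1 / 4 ≠ 0 := fun t => by positivity
    have : ρ = fun t => (((t ^ 2 - 1 / 4) / (t ^ 2 + 1 / 4) : ℝ) : ℂ) +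
        ((t / (t ^ 2 + 1 / 4) : ℝ) : ℂ) * Complex.I := by
      funext t
      exact Complex.mk_eq_add_mul_I _ _
    rw [this]
    refine Continuous.add (Complex.continuous_ofReal.comp ?_)
      ((Complex.continuous_ofReal.comp ?_).mul continuous_const)
    · exact Continuous.div (by fun_prop) (by fun_prop) h4
    · exact Continuous.div (by fun_prop) (by fun_prop) h4
  have hρ0 : ρ 0 = -1 := by
    apply Complex.ext <;> norm_num [hρ]
  have h1 : Tendsto ρ (𝓝[>] 0) (𝓝[{z | 0 ≤ z.im}] (-1)) := by
    rw [tendsto_nhdsWithin_iff]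
    refine ⟨hρ0 ▸ (hcont.tendsto 0).mono_left nhdsWithin_le_nhds, ?_⟩
    filter_upwards [self_mem_nhdsWithin] with t ht
    have : (0 : ℝ) < t := ht
    simp only [hρ]
    positivity
  have h2 : Tendsto (fun t => ρ (-t)) (𝓝[>] 0) (𝓝[{z | z.im < 0}] (-1)) := by
    rw [tendsto_nhdsWithin_iff]
    constructor
    · have : Tendsto (fun t => ρ (-t)) (𝓝 0) (𝓝 (ρ (-0))) :=
        (hcont.comp continuous_neg).tendsto 0
      rw [neg_zero, hρ0] at this
      exact this.mono_left nhdsWithin_le_nhds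
    · filter_upwards [self_mem_nhdsWithin] with t ht
      have ht' : (0 : ℝ) < t := ht
      simp only [hρ]
      exact div_neg_of_neg_of_pos (by linarith) (by positivity)
  have h3 := (Complex.tendsto_arg_nhdsWithin_im_nonneg_of_re_neg_of_im_zero hre him).comp h1
  have h4 := (Complex.tendsto_arg_nhdsWithin_im_neg_of_re_neg_of_im_zero hre him).comp h2
  have h5 := h3.sub h4
  rw [sub_neg_eq_add, ← two_mul] at h5
  exact h5

theorem midpoint_add_notMem_segment {p q : ℂ} (hpq : p ≠ q) {t : ℝ} (ht : t ≠ 0) :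
    (p + q) / 2 + t * (Complex.I * (q - p)) ∉ segment ℝ p q := by
  rw [segment_eq_image']
  rintro ⟨s, -, hs⟩
  have hd : q - p ≠ 0 := sub_ne_zero.2 hpq.symm
  simp only [Complex.real_smul] at hs
  have h1 : (s : ℂ) = 1 / 2 + t * Complex.I := by
    apply mul_right_cancel₀ hd
    linear_combination hs
  have h2 := congrArg Complex.im h1
  simp at h2
  exact ht h2.symm

/-- `W` measures the angle under which the curve `A` from `p` to `q` is seen: off `A` it varies like
the directions to the ends, and it jumps by `2π` somewhere on `A`. -/
structure IsViewAngle (p q : ℂ) (A : Set ℂ) (W : ℂ → ℝ) : Prop where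
  eventually_sub_eq : ∀ z₀, z₀ ∉ A → ∀ᶠ z in 𝓝 z₀,
    W z - W z₀ = ((q - z) / (q - z₀)).arg - ((p - z) / (p - z₀)).arg
  exists_jump : ∃ y ∈ A, y ≠ p ∧ y ≠ q ∧ ∃ d : ℂ,
    (∀ᶠ t : ℝ in 𝓝[>] 0, y + t * d ∉ A ∧ y + (-t : ℝ) * d ∉ A) ∧
    Tendsto (fun t : ℝ => W (y + t * d) - W (y + (-t : ℝ) * d)) (𝓝[>] 0) (𝓝 (2 * Real.pi))

theorem IsViewAngle.continuousAt {p q : ℂ} {A : Set ℂ} {W : ℂ → ℝ} (h : IsViewAngle p q A W)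
    {z₀ : ℂ} (hz₀ : z₀ ∉ A) (hp : p ≠ z₀) (hq : q ≠ z₀) : ContinuousAt W z₀ := by
  have h1 : ContinuousAt (fun z => ((q - z) / (q - z₀)).arg - ((p - z) / (p - z₀)).arg + W z₀) z₀ :=
    ((continuousAt_arg_div_self hq).sub (continuousAt_arg_div_self hp)).add continuousAt_const
  refine h1.congr ?_
  filter_upwards [h.eventually_sub_eq z₀ hz₀] with z hz
  linarith

theorem tendsto_add_mul_right (y d : ℂ) :
    Tendsto (fun t : ℝ => y + t * d) (𝓝[>] 0) (𝓝 y) := by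
  have : Continuous fun t : ℝ => y + t * d := by fun_prop
  simpa using (this.tendsto 0).mono_left (nhdsWithin_le_nhds (s := Set.Ioi (0 : ℝ)))

theorem tendsto_add_neg_mul_right (y d : ℂ) :
    Tendsto (fun t : ℝ => y + (-t : ℝ) * d) (𝓝[>] 0) (𝓝 y) := by
  have : Continuous fun t : ℝ => y + (-t : ℝ) * d := by fun_prop
  simpa using (this.tendsto 0).mono_left (nhdsWithin_le_nhds (s := Set.Ioi (0 : ℝ)))

theorem isViewAngle_segment {p q : ℂ} (hpq : p ≠ q) :
    IsViewAngle p q (segment ℝ p q) (fun z => ((q - z) / (p - z)).arg) := by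
  have hd : q - p ≠ 0 := sub_ne_zero.2 hpq.symm
  refine ⟨fun z₀ hz₀ => eventually_arg_sub_eq hz₀, (p + q) / 2, ?_, ?_, ?_,
    Complex.I * (q - p), ?_, tendsto_arg_jump hpq⟩
  · rw [segment_eq_image']
    refine ⟨1 / 2, ⟨by norm_num, by norm_num⟩, ?_⟩
    simp only [Complex.real_smul]
    push_cast
    ring
  · intro h
    exact hd (by linear_combination 2 * h)
  · intro h
    exact hd (by linear_combination -2 * h)
  · filter_upwards [self_mem_nhdsWithin] with t ht
    have ht' : t ≠ 0 := ne_of_gt ht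
    exact ⟨midpoint_add_notMem_segment hpq ht',
      midpoint_add_notMem_segment hpq (neg_ne_zero.2 ht')⟩

/-- Add the view angles of the segments: the contributions of the joints telescope. The jump is
taken on the first segment, away from the remaining arc, where the other summand is continuous. -/
theorem IsPolygonalArc.exists_isViewAngle {p q : ℂ} {A : Set ℂ} (h : IsPolygonalArc p q A) :
    ∃ W, IsViewAngle p q A W := by
  induction h with
  | single p q hpq => exact ⟨_, isViewAngle_segment hpq⟩
  | cons p q r A hpq hA hmeet ih =>
    obtain ⟨W, hW⟩ := ih
    have hS := isViewAngle_segment hpq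
    refine ⟨fun z => ((q - z) / (p - z)).arg + W z, ?_, ?_⟩
    · intro z₀ hz₀
      rw [Set.mem_union, not_or] at hz₀
      filter_upwards [hS.eventually_sub_eq z₀ hz₀.1, hW.eventually_sub_eq z₀ hz₀.2] with z h1 h2
      linarith
    · obtain ⟨y, hy, hyp, hyq, d, h1, h2⟩ := hS.exists_jump
      have hyA : y ∉ A := fun h => hyq (hmeet.subset ⟨hy, h⟩)
      have hyr : y ≠ r := fun h => hyA (h ▸ hA.right_mem)
      have hop : ∀ᶠ z in 𝓝 y, z ∉ A := hA.isClosed.isOpen_compl.mem_nhds hyA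
      refine ⟨y, Or.inl hy, hyp, hyr, d, ?_, ?_⟩
      · filter_upwards [h1, (tendsto_add_mul_right y d).eventually hop,
          (tendsto_add_neg_mul_right y d).eventually hop] with t h1 h3 h4
        simp only [Set.mem_union, not_or]
        exact ⟨⟨h1.1, h3⟩, h1.2, h4⟩
      · have hc := hW.continuousAt hyA hyq.symm hyr.symm
        have h3 := (hc.tendsto.comp (tendsto_add_mul_right y d)).sub
          (hc.tendsto.comp (tendsto_add_neg_mul_right y d))
        have h4 := h2.add h3
        rw [sub_self, add_zero] at h4
        refine h4.congr fun t => ?_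
        simp only [Function.comp_apply]
        ring

namespace PlaneDrawing

variable {V : Type*} {G : SimpleGraph V} {D : PlaneDrawing G}

/-- An injective linear map from edge weights and two further reals to vertex and face values gives
the inequality by comparing dimensions. -/
theorem nontrivial_edgeSides_ncard_le [Fintype V] (hV : 0 < Fintype.card V) :
    {e | e ∈ G.edgeSet ∧ (D.edgeSides e).Nontrivial}.ncard + 2 ≤
      Fintype.card V + Nat.card D.faces := by
  classical
  have hfin := finite_faces (D := D)
  have : Fintype D.faces := hfin.fintype
  obtain ⟨v₀⟩ := Fintype.card_pos_iff.1 hV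
  set E := {e | e ∈ G.edgeSet ∧ (D.edgeSides e).Nontrivial} with hE
  have hE' : ∀ e : E, e.1 ∈ G.edgeSet := fun e => e.2.1
  have horient : ∀ e : E, ∃ (u w : V) (W : ℂ → ℝ), e.1 = s(u, w) ∧
      IsViewAngle (D.pos u) (D.pos w) (D.arc e.1) W := by
    rintro ⟨e, he, -⟩
    obtain ⟨w, h1, -, h⟩ := exists_isPolygonalArc (D := D) he (Sym2.out_fst_mem e)
    obtain ⟨W, hW⟩ := h.exists_isViewAngle
    exact ⟨_, w, W, h1, hW⟩
  choose u w W hew hW using horient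
  have hpt : ∀ f : D.faces, ∃ z, z ∈ f.1 := fun f => component_nonempty f.2
  choose pt hpt using hpt
  -- The weights form a flow with an extra source at `v₀`. The outputs are its net flow at each
  -- vertex and the weighted sum of view angles, shifted by a constant, at one point of each face.
  let M : ((E → ℝ) × ℝ × ℝ) →ₗ[ℝ] ((V → ℝ) × (D.faces → ℝ)) :=
    { toFun := fun x =>
        (fun v => (∑ e, x.1 e * (Pi.single (M := fun _ => ℝ) (w e) 1 v -
            Pi.single (M := fun _ => ℝ) (u e) 1 v)) +
            x.2.2 * Pi.single (M := fun _ => ℝ) v₀ 1 v,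
          fun f => (∑ e, x.1 e * W e (pt f)) + x.2.1)
      map_add' := by
        intro x y
        refine Prod.ext (funext fun v => ?_) (funext fun f => ?_)
        · simp only [Prod.fst_add, Prod.snd_add, Pi.add_apply, add_mul, Finset.sum_add_distrib]
          ring
        · simp only [Prod.fst_add, Prod.snd_add, Pi.add_apply, add_mul, Finset.sum_add_distrib]
          ring
      map_smul' := by
        intro r x
        refine Prod.ext (funext fun v => ?_) (funext fun f => ?_)
        · simp only [Prod.smul_fst, Prod.smul_snd, Pi.smul_apply, smul_eq_mul, RingHom.id_apply,
            mul_add, Finset.mul_sum, mul_assoc]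
        · simp only [Prod.smul_fst, Prod.smul_snd, Pi.smul_apply, smul_eq_mul, RingHom.id_apply,
            mul_add, Finset.mul_sum, mul_assoc] }
  have hM : Function.Injective M := by
    rw [injective_iff_map_eq_zero]
    rintro ⟨c, k, t⟩ h0
    have hv : ∀ v, (∑ e, c e * (Pi.single (M := fun _ => ℝ) (w e) 1 v -
        Pi.single (M := fun _ => ℝ) (u e) 1 v)) +
        t * Pi.single (M := fun _ => ℝ) v₀ 1 v = 0 := fun v => congrFun (congrArg Prod.fst h0) v
    have hf : ∀ f : D.faces, (∑ e, c e * W e (pt f)) + k = 0 :=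
      fun f => congrFun (congrArg Prod.snd h0) f
    -- Flow conservation tested against an arbitrary potential. The constant potential kills the
    -- source; the change of direction to the vertices gives local constancy of `F`.
    have hpair : ∀ θ : V → ℝ, (∑ e, c e * (θ (w e) - θ (u e))) + t * θ v₀ = 0 := by
      intro θ
      have h1 : ∑ v, θ v * ((∑ e, c e * (Pi.single (M := fun _ => ℝ) (w e) 1 v -
          Pi.single (M := fun _ => ℝ) (u e) 1 v)) + t * Pi.single (M := fun _ => ℝ) v₀ 1 v) = 0 :=
        Finset.sum_eq_zero fun v _ => by rw [hv v, mul_zero]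
      have hs : ∀ a : V, ∑ v, θ v * Pi.single (M := fun _ => ℝ) a 1 v = θ a := by
        intro a
        simp [Pi.single_apply]
      simp only [mul_add, Finset.sum_add_distrib, Finset.mul_sum] at h1
      rw [Finset.sum_comm] at h1
      rw [← h1]
      congr 1
      · refine Finset.sum_congr rfl fun e _ => ?_
        rw [← hs (w e), ← hs (u e), ← Finset.sum_sub_distrib, Finset.mul_sum]
        exact Finset.sum_congr rfl fun v _ => by ring
      · rw [← hs v₀, Finset.mul_sum]
        exact Finset.sum_congr rfl fun v _ => by ring
    have ht : t = 0 := by simpa using hpair fun _ => 1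
    subst ht
    simp only [zero_mul, add_zero] at hpair
    set F : ℂ → ℝ := fun z => ∑ e, c e * W e z with hF
    have hloc : ∀ z₀, z₀ ∉ D.carrier → ∀ᶠ z in 𝓝 z₀, F z = F z₀ := by
      intro z₀ hz₀
      have h1 := eventually_all.2 fun e : E => (hW e).eventually_sub_eq z₀
        (fun h => hz₀ (arc_subset_carrier (hE' e) h))
      filter_upwards [h1] with z hz
      rw [← sub_eq_zero, hF]
      simp only
      rw [← Finset.sum_sub_distrib, ← hpair fun v => ((D.pos v - z) / (D.pos v - z₀)).arg]
      refine Finset.sum_congr rfl fun e _ => ?_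
      rw [← mul_sub, hz e]
    have hconst : ∀ z, z ∉ D.carrier → F z = -k := by
      intro z hz
      have hfz := component_mem hz
      set f : D.faces := ⟨connectedComponentIn D.carrierᶜ z, hfz⟩ with hfdef
      have h1 : F z = F (pt f) := by
        refine isPreconnected_connectedComponentIn.induction₂ (fun x y => F x = F y) ?_ ?_ ?_
          (mem_connectedComponentIn hz) (hpt f)
        · intro x hx
          filter_upwards [nhdsWithin_le_nhds (hloc x (connectedComponentIn_subset _ _ hx))]
            with y hy using hy.symm
        · exact fun x y z _ _ _ h h' => h.trans h'
        · exact fun x y _ _ h => h.symm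
      have := hf f
      rw [h1]
      linarith
    -- `F` has the same value in all faces, but across this edge it jumps by 2π times the weight,
    -- the other view angles being continuous there.
    have hc : ∀ e, c e = 0 := by
      intro e₀
      obtain ⟨y, hy, hyu, hyw, d, h1, h2⟩ := (hW e₀).exists_jump
      have hyi : y ∈ D.inner e₀.1 := by
        have hadj := hE' e₀
        rw [hew e₀] at hy hadj ⊢
        rw [inner_eq hadj]
        refine ⟨hy, ?_⟩
        simp only [Set.mem_insert_iff, Set.mem_singleton_iff, not_or]
        exact ⟨hyu, hyw⟩
      have hiff := eventually_mem_carrier_iff (hE' e₀) hyi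
      have h3 : ∀ᶠ t : ℝ in 𝓝[>] 0, F (y + t * d) - F (y + (-t : ℝ) * d) = 0 := by
        filter_upwards [h1, (tendsto_add_mul_right y d).eventually hiff,
          (tendsto_add_neg_mul_right y d).eventually hiff] with t h1 h3 h4
        rw [hconst _ (fun h => h1.1 (h3.1 h)), hconst _ (fun h => h1.2 (h4.1 h)), sub_self]
      have h4 : Tendsto (fun t : ℝ => F (y + t * d) - F (y + (-t : ℝ) * d)) (𝓝[>] 0)
          (𝓝 (∑ e, c e * if e = e₀ then 2 * Real.pi else 0)) := by
        have h5 : ∀ t : ℝ, F (y + t * d) - F (y + (-t : ℝ) * d) =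
            ∑ e, c e * (W e (y + t * d) - W e (y + (-t : ℝ) * d)) := by
          intro t
          simp only [hF, ← Finset.sum_sub_distrib, mul_sub]
        simp only [h5]
        refine tendsto_finsetSum _ fun e _ => Tendsto.const_mul _ ?_
        split_ifs with hee
        · rw [hee]; exact h2
        · have hye := notMem_arc_of_mem_inner (hE' e₀) (hE' e) (fun h => hee (Subtype.ext h)) hyi
          have hc := (hW e).continuousAt hye (fun h => hyi.2 ⟨_, h⟩) (fun h => hyi.2 ⟨_, h⟩)
          have h6 := (hc.tendsto.comp (tendsto_add_mul_right y d)).sub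
            (hc.tendsto.comp (tendsto_add_neg_mul_right y d))
          rw [sub_self] at h6
          exact h6
      have h6 := tendsto_nhds_unique (h4.congr' h3) tendsto_const_nhds
      simp only [mul_ite, mul_zero, Finset.sum_ite_eq', Finset.mem_univ, if_true] at h6
      exact (mul_eq_zero.1 h6).resolve_right Real.two_pi_pos.ne'
    -- The compact drawing leaves out some point, and there the sum, now zero, equals `-k`.
    have hk : k = 0 := by
      have hcompact : IsCompact D.carrier := by
        refine (Set.finite_range D.pos).isCompact.union
          ((Set.toFinite G.edgeSet).isCompact_biUnion fun e he => ?_)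
        obtain ⟨w, -, -, h⟩ := exists_isPolygonalArc (D := D) he (Sym2.out_fst_mem e)
        exact h.isCompact
      obtain ⟨z, hz⟩ := (Set.ne_univ_iff_exists_notMem _).1 hcompact.ne_univ
      have := hconst z hz
      simp only [hF, hc, zero_mul, Finset.sum_const_zero] at this
      linarith
    rw [hk, funext hc]
    rfl
  have hrank := LinearMap.finrank_le_finrank_of_injective hM
  rw [Module.finrank_prod, Module.finrank_prod, Module.finrank_prod, Module.finrank_pi,
    Module.finrank_pi, Module.finrank_pi, Module.finrank_self, ← Nat.card_eq_fintype_card,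
    Nat.card_coe_set_eq, ← Nat.card_eq_fintype_card (α := D.faces)] at hrank
  omega

variable (D) in
open Classical in
/-- The faces of a drawing with their boundaries. -/
noncomputable def faceSystem [Fintype V] (hV : 0 < Fintype.card V) : FaceSystem G D.faces where
  bd f := (Set.toFinite (D.boundary f.1)).toFinset
  bd_subset f e he := by
    simp only [Set.Finite.coe_toFinset] at he
    exact he.1
  exists_other f e he := by
    rw [Set.Finite.mem_toFinset] at he
    obtain ⟨he, hf, hnt⟩ := he
    obtain ⟨a, b, hab⟩ := exists_edgeSides_eq (D := D) he
    have hne : a ≠ b := by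
      rintro rfl
      rw [hab] at hnt
      simp at hnt
    have ha : a ∈ D.edgeSides e := by rw [hab]; simp
    have hb : b ∈ D.edgeSides e := by rw [hab]; simp
    have hiff : ∀ h : D.faces, e ∈ (Set.toFinite (D.boundary h.1)).toFinset ↔ h.1 = a ∨ h.1 = b := by
      intro h
      rw [Set.Finite.mem_toFinset]
      constructor
      · rintro ⟨-, h1, -⟩
        rwa [hab] at h1
      · intro h1
        exact ⟨he, by rw [hab]; exact h1, hnt⟩
    rw [hab] at hf
    rcases hf with hf | hf
    · refine ⟨⟨b, edgeSides_subset e hb⟩, fun h => hne (hf.symm.trans (congrArg Subtype.val h).symm),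
        fun h => ?_⟩
      rw [hiff, Subtype.ext_iff, Subtype.ext_iff, hf]
    · refine ⟨⟨a, edgeSides_subset e ha⟩, fun h => hne ((congrArg Subtype.val h).trans hf),
        fun h => ?_⟩
      rw [hiff, Subtype.ext_iff, Subtype.ext_iff, hf, or_comm]
  even_bd f v := by
    have h := even_boundary (D := D) (f := f.1) v
    have h1 : {e | e ∈ D.boundary f.1 ∧ v ∈ e} =
        ((Set.toFinite (D.boundary f.1)).toFinset.filter fun e => v ∈ e : Finset _) := by
      ext e
      simp
    rw [h1, Set.ncard_coe_finset] at h
    convert h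
  connected S hS := by
    rcases S.eq_empty_or_nonempty with h | h
    · exact Or.inl h
    · right
      have h1 := eq_univ_of_closed (D := D) (S := Subtype.val '' S)
        (by rintro _ ⟨f, -, rfl⟩; exact f.2) (h.image _) (by
          rintro e he f hf g hg ⟨f', hf', rfl⟩
          by_cases hfg : f'.1 = g
          · exact ⟨f', hf', hfg⟩
          · have hnt : (D.edgeSides e).Nontrivial := ⟨_, hf, _, hg, hfg⟩
            refine ⟨⟨g, edgeSides_subset e hg⟩, hS e f' _ ?_ ?_ hf', rfl⟩
            · rw [Set.Finite.mem_toFinset]; exact ⟨he, hf, hnt⟩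
            · rw [Set.Finite.mem_toFinset]; exact ⟨he, hg, hnt⟩)
      refine Set.eq_univ_of_forall fun f => ?_
      obtain ⟨g, hg, hgf⟩ := h1.symm.subset f.2
      rwa [← Subtype.ext hgf]
  ncard_le := by
    have h := nontrivial_edgeSides_ncard_le (D := D) hV
    have h1 : {e | e ∈ G.edgeSet ∧ (D.edgeSides e).Nontrivial} =
        {e | ∃ f : D.faces, e ∈ (Set.toFinite (D.boundary f.1)).toFinset} := by
      ext e
      simp only [Set.mem_ofPred_eq, Set.Finite.mem_toFinset]
      constructor
      · rintro ⟨he, hnt⟩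
        obtain ⟨f, hf⟩ := hnt.nonempty
        exact ⟨⟨f, edgeSides_subset e hf⟩, he, hf, hnt⟩
      · rintro ⟨f, he, -, hnt⟩
        exact ⟨he, hnt⟩
    rwa [h1] at h

end PlaneDrawing

theorem lemma4p3 {V : Type*} [Fintype V] (G : SimpleGraph V) (D : PlaneDrawing G)
    (hV : 4 ≤ Fintype.card V)
    (hsmall : ∀ (i : ℕ) (C : G.Subgraph), 3 ≤ i → i ≤ 5 → SimpleGraph.IsCycleSubgraph C i →
      (SimpleGraph.dependentTriangles C).ncard ≤ i - 3)
    (hlarge : ∀ (i : ℕ) (C : G.Subgraph), 6 ≤ i → SimpleGraph.IsCycleSubgraph C i →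
      (SimpleGraph.dependentTriangles C).ncard ≤ i - 2) :
    D.faces.Finite ∧ D.faces.ncard + 2 ≤ Fintype.card V := by
  have hfin := PlaneDrawing.finite_faces (D := D)
  have : Fintype D.faces := hfin.fintype
  refine ⟨hfin, ?_⟩
  have h := (D.faceSystem (by omega)).card_add_two_le hsmall hlarge hV
  rwa [← Nat.card_eq_fintype_card, Nat.card_coe_set_eq] at h
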